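/- **Theorem 2 (empirical risk error of TKRR).** For all real $\kappa,B\ge 0$ there is a constant $C_1>0$, depending only on $\kappa$ and $B$, such that the following holds. *Setting.* Let $X\subset\mathbb R^d$ be compact, let $K$ be a continuous, symmetric, positive semi-definite kernel on $X\times X$ with $\sup_{x}K(x,x)\le\kappa$, and let $P$ be a Borel probability measure on $X$. Let $\lambda_1\ge\lambda_2\ge\dots\ge 0$ be the eigenvalues, in decreasing order, of $T_Kf(x)=\int_X K(x,y)f(y)\,dP(y)$ on $L^2(P)$, with an orthonormal sequence $(\varphi_k)_{k\ge1}$ of continuous eigenfunctions such that $T_K$ vanishes on the orthogonal complement of the $\varphi_k$ (if $T_K$ is one-to-one, the $\varphi_k$ form an orthonormal basis). Put $a_k(f)=\int_X f\varphi_k\,dP$ and $$\mathcal H=\Big\{f\in L^2(P):\ f=\sum_k a_k(f)\varphi_k,\ \ \|f\|_{\mathcal H}^2=\sum_k \frac{a_k(f)^2}{\lambda_k}<\infty\Big\},$$ where a summand with $a_k(f)=\lambda_k=0$ is $0$ and one with $a_k(f)\ne0=\lambda_k$ is $\infty$. Let $f^*\in\mathcal H$, let $1\le N\le n$ be integers and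 $\lambda>0$. Let $X_1,\dots,X_n$ be i.i.d. with law $\rho$ on $X$, and let $Y_i=f^*(X_i)+\varepsilon_i$, where $\varepsilon_1,\dots,\varepsilon_n$ are i.i.d., independent of $(X_i)_i$, with $\mathbb E\,\varepsilon_i=0$ and $\mathbb E\,\varepsilon_i^2=\sigma^2<\infty$. Put $A_N=\big[\tfrac1nK(X_i,X_j)\big]_{1\le i\le n,\,1\le j\le N}$, with singular values $\mu_1\ge\dots\ge\mu_N\ge0$, and $$\widehat f_{N,\lambda}(x)=\sum_{j=1}^N\widehat\omega_j\,\tfrac1nK(X_j,x),\qquad \widehat\omega=(A_N^{T}A_N+\lambda I_N)^{-1}A_N^{T}Y .$$ *Hypotheses.* - $H_1$: $\rho\ll P$ and $d\rho/dP\le B$ ($P$-almost everywhere). - $H_2$: the matrix $[\varphi_j(X_i)]_{1\le i\le n,\,1\le j\le N}$ has full rank. - $H_3$: there are $\widetilde\omega,\omega'\in\mathbb R^N$ with $\frac1n\sum_{j\le N}\widetilde\omega_j^2\le1$ and $\frac1n\sum_{j\le N}\omega_j'^2\le1$ such that $\sum_{j\le N}\widetilde\omega_j\frac1nK(X_j,\cdot)$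 is the best approximation of $f^*$ in $L^2(P)$ from $\mathrm{Span}\{K(X_j,\cdot):j\le N\}$, and $\sum_{k\le N}a_k(f^*)\varphi_k=\sum_{j\le N}\omega'_j\frac1nK_N(X_j,\cdot)$ on $X$, where $K_N(x,y)=\sum_{m\le N}\lambda_m\varphi_m(x)\varphi_m(y)$. *Conclusion.* Assume $H_1$. If $H_2$ and $H_3$ hold almost surely, then $$\mathbb E\Big[\frac1n\sum_{i=1}^n\big(\widehat f_{N,\lambda}(X_i)-f^*(X_i)\big)^2\Big]\le\frac\lambda2+\frac{2\sigma^2}{n}\sum_{j=1}^N\mathbb E\Big[\Big(\frac{\mu_j^2}{\mu_j^2+\lambda}\Big)^2\Big]+C_1\Big(\lambda_{N+1}\|f^*\|_{\mathcal H}^2+\frac1N\sum_{k\ge N+1}\lambda_k\|\varphi_k\|_\infty^2\Big),$$ where the last series may be $+\infty$. More generally, if $G\subseteq X^n$ is measurable and $H_2$, $H_3$ hold almost surely on the event $\{(X_1,\dots,X_n)\in G\}$, then the same bound holds with the left side replaced by $\mathbb E\big[\mathbf 1_{\{(X_1,\dots,X_n)\in G\}}\,\frac1n\sum_{i}(\widehat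 f_{N,\lambda}(X_i)-f^*(X_i))^2\big]$. -/

import Mathlib

open MeasureTheory ProbabilityTheory Filter Topology
open scoped ENNReal NNReal

namespace TKRR

noncomputable section

section Kernel

variable {X : Type*} [TopologicalSpace X] [MeasurableSpace X]

/-- A Mercer kernel: continuous, symmetric and positive semi-definite
(every matrix `[K (x i) (x j)]` on finitely many points is positive semi-definite). -/
structure IsMercerKernel (K : X → X → ℝ) : Prop where
  continuous : Continuous fun p : X × X => K p.1 p.2
  posSemidef : (Matrix.of K : Matrix X X ℝ).PosSemidef

/-- The integral operator `T_K f (x) = ∫ K(x, y) f(y) dP(y)`. -/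
def integralOp (K : X → X → ℝ) (P : Measure X) (f : X → ℝ) (x : X) : ℝ :=
  ∫ y, K x y * f y ∂P

/-- `lam 0 ≥ lam 1 ≥ … ≥ 0` are the eigenvalues of `T_K` on `L²(P)` in decreasing order, with
orthonormal continuous eigenfunctions `φ 0, φ 1, …`.  The index is shifted by one: `lam k` is the
`(k+1)`-st eigenvalue.  The field `exhaustive` says that no nonzero eigenvalue is missing: `T_K`
vanishes on the orthogonal complement of the `φ k`. (If `T_K` is one-to-one, it says that the `φ k`
are an orthonormal basis.) -/
structure IsEigensystem (K : X → X → ℝ) (P : Measure X) (lam : ℕ → ℝ) (φ : ℕ → C(X, ℝ)) :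
    Prop where
  nonneg : ∀ k, 0 ≤ lam k
  antitone : Antitone lam
  eigen : ∀ k x, integralOp K P (φ k) x = lam k * φ k x
  orthonormal : ∀ j k, ∫ x, φ j x * φ k x ∂P = if j = k then 1 else 0
  exhaustive : ∀ f : X → ℝ, MemLp f 2 P → (∀ k, ∫ x, f x * φ k x ∂P = 0) →
    ∀ᵐ x ∂P, integralOp K P f x = 0

/-- The coefficient `a_k(f) = ⟨f, φ_k⟩` in `L²(P)`. -/
def coeff (P : Measure X) (φ : ℕ → C(X, ℝ)) (f : X → ℝ) (k : ℕ) : ℝ :=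
  ∫ x, f x * φ k x ∂P

/-- The projection `π_N f = ∑_{k ≤ N} a_k(f) φ_k`, onto the span of the first `N` eigenfunctions. -/
def eigenProj (P : Measure X) (φ : ℕ → C(X, ℝ)) (N : ℕ) (f : X → ℝ) (x : X) : ℝ :=
  ∑ k ∈ Finset.range N, coeff P φ f k * φ k x

/-- The squared RKHS norm `‖f‖²_H = ∑ a_k(f)² / λ_k`, as an extended real
(a summand is `0` if `a_k(f) = 0`, and `∞` if `a_k(f) ≠ 0` and `λ_k = 0`). -/
def rkhsNormSq (P : Measure X) (lam : ℕ → ℝ) (φ : ℕ → C(X, ℝ)) (f : X → ℝ) : ℝ≥0∞ :=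
  ∑' k, ENNReal.ofReal (coeff P φ f k ^ 2) / ENNReal.ofReal (lam k)

/-- The RKHS of the kernel:
`f ∈ L²(P)`, `f = ∑ a_k(f) φ_k` in `L²(P)` and `∑ a_k(f)² / λ_k < ∞`. -/
structure MemRKHS (P : Measure X) (lam : ℕ → ℝ) (φ : ℕ → C(X, ℝ)) (f : X → ℝ) : Prop where
  memLp : MemLp f 2 P
  expansion : Tendsto (fun N => ∫ x, (f x - eigenProj P φ N f x) ^ 2 ∂P) atTop (𝓝 0)
  norm_lt_top : rkhsNormSq P lam φ f < ∞

/-- The truncated kernel `K_N(x, y) = ∑_{k ≤ N} λ_k φ_k(x) φ_k(y)`. -/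
def truncKernel (lam : ℕ → ℝ) (φ : ℕ → C(X, ℝ)) (N : ℕ) (x y : X) : ℝ :=
  ∑ k ∈ Finset.range N, lam k * φ k x * φ k y

end Kernel

section Sample

variable {X : Type*} {n N : ℕ}

/-- The random Gram matrix `A_N = [K(x_i, x_j) / n]`, `1 ≤ i ≤ n`, `1 ≤ j ≤ N`. -/
def gram (K : X → X → ℝ) (hN : N ≤ n) (x : Fin n → X) : Matrix (Fin n) (Fin N) ℝ :=
  Matrix.of fun i j => 1 / (n : ℝ) * K (x i) (x (Fin.castLE hN j))

/-- The function `∑_{j ≤ N} w_j (1/n) K(x_j, ·)`. -/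
def kernelComb (K : X → X → ℝ) (hN : N ≤ n) (x : Fin n → X) (w : Fin N → ℝ) (z : X) : ℝ :=
  ∑ j, w j * (1 / (n : ℝ) * K (x (Fin.castLE hN j)) z)

/-- The coefficients `ŵ = (A_Nᵀ A_N + λ I)⁻¹ A_Nᵀ Y`. -/
def weights (K : X → X → ℝ) (hN : N ≤ n) (reg : ℝ) (x : Fin n → X) (Y : Fin n → ℝ) :
    Fin N → ℝ :=
  (((gram K hN x).transpose * gram K hN x + reg • (1 : Matrix (Fin N) (Fin N) ℝ))⁻¹).mulVec
    ((gram K hN x).transpose.mulVec Y)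

/-- The truncated kernel ridge regression estimator `f̂_{N,λ}` from the points `x` and the
responses `Y`. -/
def estimator (K : X → X → ℝ) (hN : N ≤ n) (reg : ℝ) (x : Fin n → X) (Y : Fin n → ℝ) : X → ℝ :=
  kernelComb K hN x (weights K hN reg x Y)

/-- The singular values `μ_1 ≥ … ≥ μ_N ≥ 0` of `A_N` (here `j : Fin N` stands for `j + 1`). -/
def mu (K : X → X → ℝ) (hN : N ≤ n) (x : Fin n → X) (j : Fin N) : ℝ :=
  (Matrix.toEuclideanLin (gram K hN x)).singularValues j

/-- The empirical squared error `‖(f̂_{N,λ} - f)(x_i)‖_n²` for the responses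
`Y_i = f(x_i) + e_i`. -/
def empError (K : X → X → ℝ) (hN : N ≤ n) (reg : ℝ) (f : X → ℝ) (x : Fin n → X)
    (e : Fin n → ℝ) : ℝ :=
  1 / (n : ℝ) * ∑ i, (estimator K hN reg x (fun l => f (x l) + e l) (x i) - f (x i)) ^ 2

variable [TopologicalSpace X] [MeasurableSpace X]

/-- Hypothesis H2 at the sample `x`: the matrix `[φ_j(x_i)]`, `1 ≤ i ≤ n`, `1 ≤ j ≤ N`, has full
rank. -/
def H2 (N : ℕ) (φ : ℕ → C(X, ℝ)) (x : Fin n → X) : Prop :=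
  (Matrix.of fun (i : Fin n) (j : Fin N) => φ j (x i)).rank = min n N

/-- The function `∑_{j ≤ N} w_j (1/n) K(x_j, ·)` is the best approximation of `f` in `L²(P)` from
the span of the `K(x_j, ·)`, `j ≤ N`. -/
def IsSampleProj (K : X → X → ℝ) (P : Measure X) (hN : N ≤ n) (f : X → ℝ) (x : Fin n → X)
    (w : Fin N → ℝ) : Prop :=
  ∀ c : Fin N → ℝ,
    ∫ z, (f z - kernelComb K hN x w z) ^ 2 ∂P ≤ ∫ z, (f z - kernelComb K hN x c z) ^ 2 ∂P

/-- Hypothesis H3 at the sample `x`: for the coefficients `w` of the projection of `f` onto the span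
of the `K(x_j, ·)`, and the coefficients `w'` of the expansion of `π_N f` in the functions
`(1/n) K_N(x_j, ·)`, both `(1/n) ∑ w_j²` and `(1/n) ∑ w'_j²` are at most `1`. -/
def H3 (K : X → X → ℝ) (P : Measure X) (lam : ℕ → ℝ) (φ : ℕ → C(X, ℝ)) (hN : N ≤ n)
    (f : X → ℝ) (x : Fin n → X) : Prop :=
  ∃ w w' : Fin N → ℝ,
    IsSampleProj K P hN f x w ∧
    (∀ z, eigenProj P φ N f z = kernelComb (truncKernel lam φ N) hN x w' z) ∧
    max (1 / (n : ℝ) * ∑ j, w j ^ 2) (1 / (n : ℝ) * ∑ j, w' j ^ 2) ≤ 1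

end Sample

section Risk

variable {X : Type*} [TopologicalSpace X] [CompactSpace X] [MeasurableSpace X]
variable {Ω : Type*} [MeasurableSpace Ω] {n N : ℕ}

/-- The upper bound
`λ/2 + (2σ²/n) ∑_{j ≤ N} E[(μ_j² / (μ_j² + λ))²]
  + C₁ (λ_{N+1} ‖f‖²_H + (1/N) ∑_{k ≥ N+1} λ_k ‖φ_k‖²_∞)`
as an extended nonnegative real, for the random sample `S`.  The norm on `C(X, ℝ)` is the supremum
norm, and `lam N` is the eigenvalue `λ_{N+1}`. -/
def riskBound (C₁ : ℝ≥0) (K : X → X → ℝ) (P : Measure X) (lam : ℕ → ℝ) (φ : ℕ → C(X, ℝ))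
    (hN : N ≤ n) (reg σ : ℝ) (f : X → ℝ) (μ : Measure Ω) (S : Ω → Fin n → X) : ℝ≥0∞ :=
  ENNReal.ofReal (reg / 2)
    + ENNReal.ofReal (2 * σ ^ 2 / n) *
      ∑ j : Fin N, ∫⁻ ω, ENNReal.ofReal
        ((mu K hN (S ω) j ^ 2 / (mu K hN (S ω) j ^ 2 + reg)) ^ 2) ∂μ
    + C₁ * (ENNReal.ofReal (lam N) * rkhsNormSq P lam φ f
      + (N : ℝ≥0∞)⁻¹ * ∑' k, ENNReal.ofReal (lam (N + k) * ‖φ (N + k)‖ ^ 2))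

end Risk

end

end TKRR

/-! For a fixed design the estimator is a linear smoother: with `A = gram K hN x` its values at the
sample points are `M (f + ε)`, where `M = A (Aᵀ A + r)⁻¹ Aᵀ`. Centred independent noise splits the
expected error into the bias `‖(M - 1) f‖² / n` and the variance `σ² ‖M‖² / n` in Frobenius norm.
Diagonalizing `Aᵀ A` gives the variance term (`sum_sq_hatMatrix`).

For the bias, any `w` gives `(M - 1) f = (M - 1)(f - A w) + (M - 1) A w`. Here `M - 1` is a
contraction and `‖(M - 1) A w‖² ≤ (r / 4) ‖w‖²`, which leads to the term `r / 2`. Take for `w` the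
coefficients of `π_N f` in the truncated kernel `K_N`. Then `f - A w` is the spectral remainder `f -
π_N f` minus a combination of the tails `R = K - K_N`, handled by Cauchy-Schwarz
(`empiricalBias_le`).

In expectation, the density bound `B` replaces `ρ` by `P`. The spectral remainder costs `B λ_{N+1}
‖f‖²_H`. With `T = ∑_{k > N} λ_k ‖φ_k‖²`, a pair of distinct sample points contributes at most `B²
λ_{N+1} T` to `E R²`, and a repeated point at most `κ B T`. There are fewer than `n N` distinct
pairs and only `N` repeated ones, so the trace bound `N λ_{N+1} ≤ κ` and `N ≤ n` yield the factor `1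
/ N`.

If `T = ∞` there is nothing to prove. Otherwise the eigenfunction series converges uniformly, and it
equals `K` on the support of `P` (`kernel_eq_tailKernel_zero`), where almost all sample points lie.
-/

namespace TKRR

open Matrix

/-! ### Bias of ridge regression for a fixed matrix -/

section Ridge

variable {m p : Type*} [Fintype m] [Fintype p]

theorem dotProduct_transpose_mulVec (A : Matrix m p ℝ) (v : m → ℝ) (u : p → ℝ) :
    (Aᵀ *ᵥ v) ⬝ᵥ u = v ⬝ᵥ (A *ᵥ u) := by
  rw [mulVec_transpose, ← dotProduct_mulVec]

variable [DecidableEq p]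

theorem ridge_mulVec (A : Matrix m p ℝ) (r : ℝ) (u : p → ℝ) :
    (Aᵀ * A + r • (1 : Matrix p p ℝ)) *ᵥ u = Aᵀ *ᵥ (A *ᵥ u) + r • u := by
  rw [add_mulVec, ← mulVec_mulVec, smul_mulVec, one_mulVec]

theorem posDef_ridge (A : Matrix m p ℝ) {r : ℝ} (hr : 0 < r) :
    (Aᵀ * A + r • (1 : Matrix p p ℝ)).PosDef := by
  have h := (posSemidef_conjTranspose_mul_self A)
  rw [conjTranspose_eq_transpose_of_trivial] at h
  exact PosDef.posSemidef_add h (PosDef.one.smul hr)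

theorem isUnit_det_ridge (A : Matrix m p ℝ) {r : ℝ} (hr : 0 < r) :
    IsUnit (Aᵀ * A + r • (1 : Matrix p p ℝ)).det :=
  (posDef_ridge A hr).det_pos.ne'.isUnit

theorem ridge_mulVec_inv_mulVec (A : Matrix m p ℝ) {r : ℝ} (hr : 0 < r) (v : p → ℝ) :
    Aᵀ *ᵥ (A *ᵥ ((Aᵀ * A + r • (1 : Matrix p p ℝ))⁻¹ *ᵥ v))
      + r • ((Aᵀ * A + r • (1 : Matrix p p ℝ))⁻¹ *ᵥ v) = v := by
  rw [← ridge_mulVec, mulVec_mulVec, mul_nonsing_inv _ (isUnit_det_ridge A hr), one_mulVec]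

/-- The smoothing matrix `A (Aᵀ A + r)⁻¹ Aᵀ` of ridge regression. -/
noncomputable def hatMatrix (A : Matrix m p ℝ) (r : ℝ) : Matrix m m ℝ :=
  A * (Aᵀ * A + r • (1 : Matrix p p ℝ))⁻¹ * Aᵀ

theorem hatMatrix_mulVec (A : Matrix m p ℝ) (r : ℝ) (v : m → ℝ) :
    hatMatrix A r *ᵥ v = A *ᵥ ((Aᵀ * A + r • (1 : Matrix p p ℝ))⁻¹ *ᵥ (Aᵀ *ᵥ v)) := by
  simp [hatMatrix, mulVec_mulVec, Matrix.mul_assoc]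

/-- With `u = (Aᵀ A + r)⁻¹ Aᵀ v` the normal equations give `⟨v, A u⟩ = ‖A u‖² + r ‖u‖²`, hence `‖A u
- v‖² = ‖v‖² - ‖A u‖² - 2 r ‖u‖²`. -/
theorem hatMatrix_residual_le (A : Matrix m p ℝ) {r : ℝ} (hr : 0 < r) (v : m → ℝ) :
    (hatMatrix A r *ᵥ v - v) ⬝ᵥ (hatMatrix A r *ᵥ v - v) ≤ v ⬝ᵥ v := by
  rw [hatMatrix_mulVec]
  have h := ridge_mulVec_inv_mulVec A hr (Aᵀ *ᵥ v)
  set u := (Aᵀ * A + r • (1 : Matrix p p ℝ))⁻¹ *ᵥ (Aᵀ *ᵥ v)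
  have h2 : v ⬝ᵥ (A *ᵥ u) = (A *ᵥ u) ⬝ᵥ (A *ᵥ u) + r * (u ⬝ᵥ u) := by
    rw [← dotProduct_transpose_mulVec, ← h, add_dotProduct, dotProduct_transpose_mulVec,
      smul_dotProduct, smul_eq_mul]
  have h3 : 0 ≤ u ⬝ᵥ u := by simpa using dotProduct_star_self_nonneg u
  have h4 : 0 ≤ (A *ᵥ u) ⬝ᵥ (A *ᵥ u) := by simpa using dotProduct_star_self_nonneg (A *ᵥ u)
  simp only [sub_dotProduct, dotProduct_sub, dotProduct_comm (A *ᵥ u) v, h2]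
  nlinarith

/-- On a singular direction this is `r s / (s² + r) ≤ √r / 2`. Without diagonalizing: for `u = (Aᵀ A
+ r)⁻¹ w` the residual is `-r A u`, and `‖w‖² - 4 r ‖A u‖² = ‖Aᵀ A u - r u‖² ≥ 0`. -/
theorem hatMatrix_residual_range_le (A : Matrix m p ℝ) {r : ℝ} (hr : 0 < r) (w : p → ℝ) :
    (hatMatrix A r *ᵥ (A *ᵥ w) - A *ᵥ w) ⬝ᵥ (hatMatrix A r *ᵥ (A *ᵥ w) - A *ᵥ w)
      ≤ r / 4 * (w ⬝ᵥ w) := by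
  have h := ridge_mulVec_inv_mulVec A hr w
  set H := (Aᵀ * A + r • (1 : Matrix p p ℝ)) with hH
  set u := H⁻¹ *ᵥ w with hu
  have e : hatMatrix A r *ᵥ (A *ᵥ w) - A *ᵥ w = -(r • (A *ᵥ u)) := by
    have h1 : Aᵀ *ᵥ (A *ᵥ w) = H *ᵥ w - r • w := by
      rw [hH, ridge_mulVec, add_sub_cancel_right]
    rw [hatMatrix_mulVec, ← hH, h1, mulVec_sub, mulVec_mulVec, nonsing_inv_mul _
      (isUnit_det_ridge A hr), one_mulVec, mulVec_smul, mulVec_sub, mulVec_smul, ← hu]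
    abel
  have h3 : 0 ≤ (Aᵀ *ᵥ (A *ᵥ u) - r • u) ⬝ᵥ (Aᵀ *ᵥ (A *ᵥ u) - r • u) := by
    simpa using dotProduct_star_self_nonneg (Aᵀ *ᵥ (A *ᵥ u) - r • u)
  have h5 : (Aᵀ *ᵥ (A *ᵥ u)) ⬝ᵥ u = (A *ᵥ u) ⬝ᵥ (A *ᵥ u) := dotProduct_transpose_mulVec A _ u
  rw [e, ← h]
  simp only [sub_dotProduct, dotProduct_sub, add_dotProduct, dotProduct_add, smul_dotProduct,
    dotProduct_smul, neg_dotProduct, dotProduct_neg, smul_eq_mul,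
    dotProduct_comm u (Aᵀ *ᵥ (A *ᵥ u)), h5] at h3 ⊢
  nlinarith

theorem dotProduct_add_self_le (a b : m → ℝ) :
    (a + b) ⬝ᵥ (a + b) ≤ 2 * (a ⬝ᵥ a) + 2 * (b ⬝ᵥ b) := by
  have h : 0 ≤ (a - b) ⬝ᵥ (a - b) := by simpa using dotProduct_star_self_nonneg (a - b)
  simp only [sub_dotProduct, dotProduct_sub, add_dotProduct, dotProduct_add] at h ⊢
  linarith

/-- The bias of ridge regression is controlled by any comparison vector `w`. -/
theorem hatMatrix_bias_le (A : Matrix m p ℝ) {r : ℝ} (hr : 0 < r) (v : m → ℝ) (w : p → ℝ) :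
    (hatMatrix A r *ᵥ v - v) ⬝ᵥ (hatMatrix A r *ᵥ v - v)
      ≤ 2 * ((v - A *ᵥ w) ⬝ᵥ (v - A *ᵥ w)) + r / 2 * (w ⬝ᵥ w) := by
  have h1 := hatMatrix_residual_le A hr (v - A *ᵥ w)
  have h2 := hatMatrix_residual_range_le A hr w
  have h3 := dotProduct_add_self_le (hatMatrix A r *ᵥ (v - A *ᵥ w) - (v - A *ᵥ w))
    (hatMatrix A r *ᵥ (A *ᵥ w) - A *ᵥ w)
  have e : hatMatrix A r *ᵥ (v - A *ᵥ w) - (v - A *ᵥ w) + (hatMatrix A r *ᵥ (A *ᵥ w) - A *ᵥ w)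
      = hatMatrix A r *ᵥ v - v := by
    rw [mulVec_sub]; abel
  rw [e] at h3
  linarith

end Ridge

/-! ### Singular values and the Frobenius norm of the smoother -/

section SingularValues

variable {n N : ℕ}

theorem exists_orthogonal_diagonalization (A : Matrix (Fin n) (Fin N) ℝ) :
    ∃ U : Matrix (Fin N) (Fin N) ℝ, Uᵀ * U = 1 ∧ U * Uᵀ = 1 ∧
      Aᵀ * A = U * diagonal (fun j : Fin N => (toEuclideanLin A).singularValues j ^ 2) * Uᵀ := by
  have hf : Module.finrank ℝ (EuclideanSpace ℝ (Fin N)) = N := finrank_euclideanSpace_fin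
  set T := toEuclideanLin A
  set b := T.isSymmetric_adjoint_comp_self.eigenvectorBasis hf
  let U : Matrix (Fin N) (Fin N) ℝ := of fun i j => b j i
  have h1 : Uᵀ * U = 1 := by
    ext i j
    have := orthonormal_iff_ite.mp b.orthonormal j i
    simp only [PiLp.inner_apply, RCLike.inner_apply, conj_trivial] at this
    simp [mul_apply, U, one_apply, this, eq_comm]
  have h2 : U * Uᵀ = 1 := mul_eq_one_comm.mp h1
  refine ⟨U, h1, h2, ?_⟩
  have h3 : Aᵀ * A * U = U * diagonal (fun j : Fin N => T.singularValues j ^ 2) := by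
    ext i j
    have h := T.isSymmetric_adjoint_comp_self.apply_eigenvectorBasis hf j
    rw [← T.sq_singularValues_fin hf j] at h
    have hadj : LinearMap.adjoint T = toEuclideanLin Aᵀ := by
      rw [← toEuclideanLin_conjTranspose_eq_adjoint, conjTranspose_eq_transpose_of_trivial]
    change (LinearMap.adjoint T) (T (b j)) = (T.singularValues j ^ 2 : ℝ) • b j at h
    rw [hadj] at h
    have h' := congrArg (fun v : EuclideanSpace ℝ (Fin N) => v i) h
    simp only [PiLp.smul_apply, smul_eq_mul] at h'
    rw [mul_diagonal, mul_comm]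
    refine Eq.trans ?_ h'
    have : (Aᵀ * A * U) i j = ((Aᵀ * A) *ᵥ (b j).ofLp) i := rfl
    rw [this, ← mulVec_mulVec]
    rfl
  rw [← h3, Matrix.mul_assoc, h2, Matrix.mul_one]

/-- The left side is polynomial in the entries of `A`; this is how measurability reaches the
singular values of a random matrix. -/
theorem trace_pow_transpose_mul_self (A : Matrix (Fin n) (Fin N) ℝ) (k : ℕ) :
    ((Aᵀ * A) ^ k).trace = ∑ j : Fin N, ((toEuclideanLin A).singularValues j ^ 2) ^ k := by
  obtain ⟨U, h1, h2, h3⟩ := exists_orthogonal_diagonalization A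
  set D := diagonal (fun j : Fin N => (toEuclideanLin A).singularValues j ^ 2) with hD
  have h4 : (Aᵀ * A) ^ k = U * D ^ k * Uᵀ := by
    induction k with
    | zero => simp [h2]
    | succ k ih =>
      rw [pow_succ, ih, h3, pow_succ]
      simp only [Matrix.mul_assoc]
      rw [← Matrix.mul_assoc Uᵀ U, h1, Matrix.one_mul]
  rw [h4, trace_mul_comm, ← Matrix.mul_assoc, h1, Matrix.one_mul, hD, diagonal_pow, trace_diagonal]
  rfl

/-- The smoother `M` is symmetric, so its squared Frobenius norm is `tr (M²)`. By cyclicity this is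
the trace of the square of `Aᵀ A (Aᵀ A + r)⁻¹`, which is diagonal in the eigenbasis of `Aᵀ A`. -/
theorem sum_sq_hatMatrix (A : Matrix (Fin n) (Fin N) ℝ) {r : ℝ} (hr : 0 < r) :
    ∑ i, ∑ l, hatMatrix A r i l ^ 2 = ∑ j : Fin N,
      ((toEuclideanLin A).singularValues j ^ 2 /
        ((toEuclideanLin A).singularValues j ^ 2 + r)) ^ 2 := by
  obtain ⟨U, h1, h2, h3⟩ := exists_orthogonal_diagonalization A
  set s := fun j : Fin N => (toEuclideanLin A).singularValues j ^ 2 with hs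
  have hs0 : ∀ j, s j + r ≠ 0 := fun j => by positivity
  set H := Aᵀ * A + r • (1 : Matrix (Fin N) (Fin N) ℝ) with hH
  have hH' : H = U * diagonal (fun j => s j + r) * Uᵀ := by
    have : diagonal (fun j => s j + r) = diagonal s + r • (1 : Matrix (Fin N) (Fin N) ℝ) := by
      rw [smul_one_eq_diagonal, diagonal_add]
    rw [this, Matrix.mul_add, Matrix.add_mul, ← h3, hH]
    simp [h2]
  have hinv : H⁻¹ = U * diagonal (fun j => (s j + r)⁻¹) * Uᵀ := by
    apply inv_eq_right_inv
    rw [hH']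
    simp only [Matrix.mul_assoc]
    rw [← Matrix.mul_assoc Uᵀ U, h1, Matrix.one_mul, ← Matrix.mul_assoc (diagonal _) (diagonal _),
      diagonal_mul_diagonal]
    simp [hs0, h2]
  have hsymm : (hatMatrix A r)ᵀ = hatMatrix A r := by
    have : H⁻¹ᵀ = H⁻¹ := by
      rw [hinv]; simp [transpose_mul, Matrix.mul_assoc]
    simp only [hatMatrix, ← hH, transpose_mul, this, transpose_transpose, Matrix.mul_assoc]
  have htr : ∑ i, ∑ l, hatMatrix A r i l ^ 2 = (hatMatrix A r * hatMatrix A r).trace := by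
    nth_rw 3 [← hsymm]
    simp [trace, mul_apply, sq]
  have hP : Aᵀ * A * H⁻¹ = U * diagonal (fun j => s j / (s j + r)) * Uᵀ := by
    rw [h3, hinv]
    simp only [Matrix.mul_assoc]
    rw [← Matrix.mul_assoc Uᵀ U, h1, Matrix.one_mul, ← Matrix.mul_assoc (diagonal _) (diagonal _),
      diagonal_mul_diagonal]
    simp [div_eq_mul_inv]
  have hQ : (hatMatrix A r * hatMatrix A r).trace
      = ((Aᵀ * A * H⁻¹) * (Aᵀ * A * H⁻¹)).trace := by
    simp only [hatMatrix, ← hH, Matrix.mul_assoc]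
    have h := trace_mul_comm H⁻¹ (Aᵀ * A * H⁻¹ * (Aᵀ * A))
    rw [trace_mul_comm A]
    simpa only [Matrix.mul_assoc] using h
  rw [htr, hQ, hP]
  simp only [Matrix.mul_assoc]
  rw [← Matrix.mul_assoc Uᵀ U, h1, Matrix.one_mul, trace_mul_comm]
  simp only [Matrix.mul_assoc]
  rw [h1, Matrix.mul_one, diagonal_mul_diagonal, trace_diagonal]
  simp [sq, hs]

end SingularValues

/-! ### Measurability of singular values and of the smoother -/

section Measurability

theorem tendsto_rpow_inv_of_le_of_le {c f : ℝ} (hc : 1 ≤ c) (hf : 0 ≤ f) {g : ℕ → ℝ}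
    (h1 : ∀ k, f ^ (k + 1) ≤ g k) (h2 : ∀ k, g k ≤ c * f ^ (k + 1)) :
    Tendsto (fun k : ℕ => g k ^ ((1 : ℝ) / ((k : ℝ) + 1))) atTop (𝓝 f) := by
  have hroot : ∀ k : ℕ, (f ^ (k + 1)) ^ ((1 : ℝ) / ((k : ℝ) + 1)) = f := fun k => by
    rw [one_div]
    exact_mod_cast Real.pow_rpow_inv_natCast hf (Nat.succ_ne_zero k)
  have hlim : Tendsto (fun k : ℕ => c ^ ((1 : ℝ) / ((k : ℝ) + 1)) * f) atTop (𝓝 f) := by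
    have h : Tendsto (fun k : ℕ => c ^ ((1 : ℝ) / ((k : ℝ) + 1))) atTop (𝓝 (c ^ (0 : ℝ))) :=
      ((Real.continuous_const_rpow (by positivity)).tendsto 0).comp
        tendsto_one_div_add_atTop_nhds_zero_nat
    simpa using h.mul_const f
  refine tendsto_of_tendsto_of_tendsto_of_le_of_le tendsto_const_nhds hlim (fun k => ?_)
    fun k => ?_
  · have h := Real.rpow_le_rpow (by positivity) (h1 k)
      (by positivity : 0 ≤ (1 : ℝ) / ((k : ℝ) + 1))
    rwa [hroot] at h
  · have hp := pow_nonneg hf (k + 1)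
    have h := Real.rpow_le_rpow (hp.trans (h1 k)) (h2 k)
      (by positivity : 0 ≤ (1 : ℝ) / ((k : ℝ) + 1))
    rwa [Real.mul_rpow (by positivity) hp, hroot] at h

/-- The members of a decreasing finite family of nonnegative functions are measurable as soon as
their power sums are. -/
theorem measurable_of_measurable_sum_pow {α : Type*} [MeasurableSpace α] {N : ℕ}
    {f : Fin N → α → ℝ} (h0 : ∀ j a, 0 ≤ f j a) (hanti : ∀ a, Antitone fun j => f j a)
    (hm : ∀ k, Measurable fun a => ∑ j, f j a ^ k) (j : Fin N) : Measurable (f j) := by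
  induction j using WellFoundedLT.induction with
  | _ j ih =>
    -- Once the members before `j` are known to be measurable, subtract their powers. The remaining
    -- power sum lies between `f j a ^ (k + 1)` and `N * f j a ^ (k + 1)`, so its roots converge to
    -- `f j a`.
    have hsplit : ∀ k a, ∑ i, f i a ^ k - ∑ i ∈ Finset.univ.filter (· < j), f i a ^ k
        = ∑ i ∈ Finset.univ.filter (¬ · < j), f i a ^ k := fun k a => by
      rw [sub_eq_iff_eq_add', Finset.sum_filter_add_sum_filter_not]
    refine measurable_of_tendsto_metrizable
      (f := fun (k : ℕ) a => (∑ i, f i a ^ (k + 1) -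
        ∑ i ∈ Finset.univ.filter (· < j), f i a ^ (k + 1)) ^ ((1 : ℝ) / ((k : ℝ) + 1)))
      (fun k => ((hm _).sub (Finset.measurable_sum _ fun i hi =>
        (ih i (Finset.mem_filter.mp hi).2).pow_const _)).pow_const _) ?_
    rw [tendsto_pi_nhds]
    intro a
    have hN : 1 ≤ (N : ℝ) := by exact_mod_cast j.pos
    refine tendsto_rpow_inv_of_le_of_le hN (h0 j a) (fun k => ?_) (fun k => ?_)
    · rw [hsplit]
      exact Finset.single_le_sum (f := fun i => f i a ^ (k + 1))
        (fun i _ => pow_nonneg (h0 i a) _) (by simp)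
    · rw [hsplit]
      calc ∑ i ∈ Finset.univ.filter (¬ · < j), f i a ^ (k + 1)
          ≤ ∑ i ∈ Finset.univ.filter (¬ · < j), f j a ^ (k + 1) :=
            Finset.sum_le_sum fun i hi => pow_le_pow_left₀ (h0 i a)
              (hanti a (not_lt.mp (Finset.mem_filter.mp hi).2)) _
        _ ≤ N * f j a ^ (k + 1) := by
            rw [Finset.sum_const, nsmul_eq_mul]
            gcongr
            · exact pow_nonneg (h0 j a) _
            · exact (Finset.card_filter_le _ _).trans (by simp)

variable {X : Type*} [TopologicalSpace X] {n N : ℕ}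

theorem continuous_gram {K : X → X → ℝ} (hK : Continuous fun p : X × X => K p.1 p.2)
    (hN : N ≤ n) : Continuous fun x : Fin n → X => gram K hN x :=
  continuous_matrix fun i j => continuous_const.mul
    (hK.comp (f := fun x : Fin n → X => (x i, x (Fin.castLE hN j))) (by fun_prop))

theorem measurable_mu_sq [MeasurableSpace X] [SecondCountableTopology X] [OpensMeasurableSpace X]
    {K : X → X → ℝ} (hK : Continuous fun p : X × X => K p.1 p.2) (hN : N ≤ n) (j : Fin N) :
    Measurable fun x : Fin n → X => mu K hN x j ^ 2 := by
  refine measurable_of_measurable_sum_pow (f := fun j (x : Fin n → X) => mu K hN x j ^ 2)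
    (fun _ _ => sq_nonneg _) (fun x i i' h => ?_) (fun k => ?_) j
  · exact pow_le_pow_left₀ (LinearMap.singularValues_nonneg _ _)
      (LinearMap.singularValues_antitone _ h) 2
  · have h := continuous_gram hK hN
    simp only [mu, ← trace_pow_transpose_mul_self]
    exact ((h.matrix_transpose.matrix_mul h).pow k).matrix_trace.measurable

theorem continuous_hatMatrix_gram {K : X → X → ℝ} (hK : Continuous fun p : X × X => K p.1 p.2)
    (hN : N ≤ n) {r : ℝ} (hr : 0 < r) :
    Continuous fun x : Fin n → X => hatMatrix (gram K hN x) r := by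
  have h := continuous_gram hK hN
  have hH : Continuous fun x : Fin n → X =>
      (gram K hN x)ᵀ * gram K hN x + r • (1 : Matrix (Fin N) (Fin N) ℝ) :=
    (h.matrix_transpose.matrix_mul h).add continuous_const
  refine (h.matrix_mul ?_).matrix_mul h.matrix_transpose
  simp only [Matrix.inv_def, Ring.inverse_eq_inv']
  exact (hH.matrix_det.inv₀ fun x => (isUnit_det_ridge _ hr).ne_zero).smul hH.matrix_adjugate

end Measurability

/-! ### Mercer expansion on the support and its tail -/

section Mercer

theorem eq_zero_of_ae_eq_zero_of_mem_support {X : Type*} [TopologicalSpace X] [MeasurableSpace X]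
    {P : Measure X} {g : X → ℝ} (hg : Continuous g) (h : ∀ᵐ x ∂P, g x = 0) {x : X}
    (hx : x ∈ P.support) : g x = 0 := by
  by_contra hne
  have ho : IsOpen {x | g x ≠ 0} := isOpen_ne_fun hg continuous_const
  exact Measure.subset_compl_support_of_isOpen ho h hne hx

/-- The remainder `∑_{k > N} λ_k φ_k(x) φ_k(y)` of the Mercer expansion. -/
noncomputable def tailKernel {X : Type*} [TopologicalSpace X] (lam : ℕ → ℝ) (φ : ℕ → C(X, ℝ))
    (N : ℕ) (x y : X) : ℝ :=
  ∑' k, lam (N + k) * φ (N + k) x * φ (N + k) y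

variable {X : Type*} [TopologicalSpace X] {lam : ℕ → ℝ} {φ : ℕ → C(X, ℝ)}

theorem tailKernel_self_nonneg (hlam : ∀ k, 0 ≤ lam k) (N : ℕ) (x : X) :
    0 ≤ tailKernel lam φ N x x :=
  tsum_nonneg fun k => by
    rw [mul_assoc]
    exact mul_nonneg (hlam _) (mul_self_nonneg _)

theorem truncKernel_self_nonneg (hlam : ∀ k, 0 ≤ lam k) (N : ℕ) (x : X) :
    0 ≤ truncKernel lam φ N x x :=
  Finset.sum_nonneg fun k _ => by
    rw [mul_assoc]
    exact mul_nonneg (hlam _) (mul_self_nonneg _)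

variable [CompactSpace X]

theorem abs_mercer_term_le (hlam : ∀ k, 0 ≤ lam k) (k : ℕ) (x y : X) :
    ‖lam k * φ k x * φ k y‖ ≤ lam k * ‖φ k‖ ^ 2 := by
  rw [norm_mul, norm_mul, Real.norm_of_nonneg (hlam k), mul_assoc, sq]
  gcongr
  · exact hlam k
  · exact (φ k).norm_coe_le_norm x
  · exact (φ k).norm_coe_le_norm y

theorem summable_shift {f : ℕ → ℝ} (hf : Summable f) (N : ℕ) : Summable fun k => f (N + k) := by
  simpa only [add_comm] using (summable_nat_add_iff N).mpr hf

theorem summable_mercer_term (hlam : ∀ k, 0 ≤ lam k)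
    (hS : Summable fun k => lam k * ‖φ k‖ ^ 2) (x y : X) :
    Summable fun k => lam k * φ k x * φ k y :=
  hS.of_norm_bounded fun k => abs_mercer_term_le hlam k x y

theorem continuous_tailKernel (hlam : ∀ k, 0 ≤ lam k)
    (hS : Summable fun k => lam k * ‖φ k‖ ^ 2) (N : ℕ) :
    Continuous fun p : X × X => tailKernel lam φ N p.1 p.2 :=
  continuous_tsum (fun k => by fun_prop) (summable_shift hS N)
    fun k p => abs_mercer_term_le hlam _ p.1 p.2

theorem truncKernel_add_tailKernel (hlam : ∀ k, 0 ≤ lam k)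
    (hS : Summable fun k => lam k * ‖φ k‖ ^ 2) (N : ℕ) (x y : X) :
    truncKernel lam φ N x y + tailKernel lam φ N x y = tailKernel lam φ 0 x y := by
  have h := (summable_mercer_term hlam hS x y).sum_add_tsum_nat_add N
  simp only [truncKernel, tailKernel, zero_add]
  simpa only [add_comm N] using h

variable [MeasurableSpace X] [BorelSpace X] {P : Measure X} [IsProbabilityMeasure P]

theorem integrable_of_continuous {f : X → ℝ} (hf : Continuous f) : Integrable f P :=
  hf.integrable_of_hasCompactSupport (HasCompactSupport.of_compactSpace f)

theorem hasSum_integral_tailKernel_mul (hlam : ∀ k, 0 ≤ lam k)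
    (hS : Summable fun k => lam k * ‖φ k‖ ^ 2) (N : ℕ) (x : X) (g : C(X, ℝ)) :
    HasSum (fun k => lam (N + k) * φ (N + k) x * ∫ y, φ (N + k) y * g y ∂P)
      (∫ y, tailKernel lam φ N x y * g y ∂P) := by
  have hint : ∀ k, Integrable (fun y => lam (N + k) * φ (N + k) x * φ (N + k) y * g y) P :=
    fun k => integrable_of_continuous (by fun_prop)
  have hsum : Summable fun k => ∫ y, ‖lam (N + k) * φ (N + k) x * φ (N + k) y * g y‖ ∂P := by
    refine ((summable_shift hS N).mul_right ‖g‖).of_nonneg_of_le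
      (fun k => integral_nonneg fun y => norm_nonneg _) fun k => ?_
    have h := integral_mono (μ := P) (hint k).norm (integrable_const _) fun y => (by
      rw [norm_mul]
      exact mul_le_mul (abs_mercer_term_le hlam (N + k) x y) (g.norm_coe_le_norm y)
        (norm_nonneg _) (mul_nonneg (hlam _) (sq_nonneg _)) :
      ‖lam (N + k) * φ (N + k) x * φ (N + k) y * g y‖ ≤ lam (N + k) * ‖φ (N + k)‖ ^ 2 * ‖g‖)
    simpa using h
  have h := hasSum_integral_of_summable_integral_norm hint hsum
  simp only [tailKernel, ← tsum_mul_right]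
  simpa only [mul_assoc, integral_const_mul] using h

variable {K : X → X → ℝ}

theorem integral_tailKernel_mul_eigenfunction (hE : IsEigensystem K P lam φ)
    (hS : Summable fun k => lam k * ‖φ k‖ ^ 2) (N m : ℕ) (x : X) :
    ∫ y, tailKernel lam φ N x y * φ (N + m) y ∂P = lam (N + m) * φ (N + m) x := by
  rw [← (hasSum_integral_tailKernel_mul hE.nonneg hS N x (φ (N + m))).tsum_eq]
  simp only [hE.orthonormal]
  rw [tsum_eq_single m]
  · simp
  · intro k hk
    simp [hk]

/-- Orthonormality turns the left side into `∑ λ_k² φ_k(x)²` over the tail; one factor `λ_k` is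
bounded by the largest tail eigenvalue `lam N`. -/
theorem integral_tailKernel_sq_le (hE : IsEigensystem K P lam φ)
    (hS : Summable fun k => lam k * ‖φ k‖ ^ 2) (N : ℕ) (x : X) :
    ∫ y, tailKernel lam φ N x y ^ 2 ∂P ≤ lam N * tailKernel lam φ N x x := by
  have hc : Continuous (tailKernel lam φ N x) :=
    (continuous_tailKernel hE.nonneg hS N).comp (Continuous.prodMk_right x)
  have h := hasSum_integral_tailKernel_mul (P := P) hE.nonneg hS N x ⟨_, hc⟩
  have h' := (((summable_shift (summable_mercer_term hE.nonneg hS x x) N).hasSum).mul_left (lam N))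
  simp only [sq]
  refine hasSum_le (fun k => ?_) h h'
  simp only [ContinuousMap.coe_mk]
  have e : ∫ y, φ (N + k) y * tailKernel lam φ N x y ∂P = lam (N + k) * φ (N + k) x := by
    rw [← integral_tailKernel_mul_eigenfunction hE hS N k x]
    simp only [mul_comm]
  rw [e]
  have h1 : lam (N + k) ≤ lam N := hE.antitone (Nat.le_add_right N k)
  have h2 := hE.nonneg (N + k)
  have h3 : lam (N + k) * φ (N + k) x * (lam (N + k) * φ (N + k) x)
    = lam (N + k) * (lam (N + k) * φ (N + k) x * φ (N + k) x) := by ring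
  rw [h3]
  exact mul_le_mul_of_nonneg_right h1 (by rw [mul_assoc]; exact mul_nonneg h2 (mul_self_nonneg _))

theorem integral_truncKernel_self (hE : IsEigensystem K P lam φ) (N : ℕ) :
    ∫ x, truncKernel lam φ N x x ∂P = ∑ k ∈ Finset.range N, lam k := by
  simp only [truncKernel]
  rw [integral_finsetSum _ fun k _ => integrable_of_continuous (by fun_prop)]
  refine Finset.sum_congr rfl fun k _ => ?_
  simp only [mul_assoc]
  rw [integral_const_mul, hE.orthonormal]
  simp

theorem lintegral_tailKernel_self_le (hE : IsEigensystem K P lam φ)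
    (hS : Summable fun k => lam k * ‖φ k‖ ^ 2) (N : ℕ) :
    ∫⁻ x, ENNReal.ofReal (tailKernel lam φ N x x) ∂P
      ≤ ∑' k, ENNReal.ofReal (lam (N + k) * ‖φ (N + k)‖ ^ 2) := by
  have hnn : ∀ k (x : X), 0 ≤ lam k * φ k x * φ k x := fun k x => by
    rw [mul_assoc]; exact mul_nonneg (hE.nonneg k) (mul_self_nonneg _)
  have e : ∀ x, ENNReal.ofReal (tailKernel lam φ N x x)
      = ∑' k, ENNReal.ofReal (lam (N + k) * φ (N + k) x * φ (N + k) x) := fun x =>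
    ENNReal.ofReal_tsum_of_nonneg (fun k => hnn _ x)
      (summable_shift (summable_mercer_term hE.nonneg hS x x) N)
  simp only [e]
  rw [lintegral_tsum fun k => (by fun_prop)]
  refine ENNReal.tsum_le_tsum fun k => ?_
  have hb : ∀ x, ENNReal.ofReal (lam (N + k) * φ (N + k) x * φ (N + k) x)
      ≤ ENNReal.ofReal (lam (N + k) * ‖φ (N + k)‖ ^ 2) := fun x =>
    ENNReal.ofReal_le_ofReal ((Real.le_norm_self _).trans (abs_mercer_term_le hE.nonneg _ x x))
  refine (lintegral_mono hb).trans ?_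
  simp

variable [SecondCountableTopology X] [T2Space X]

/-- Mercer's theorem on the support of the measure, for a uniformly summable expansion. -/
theorem kernel_eq_tailKernel_zero (hK : Continuous fun p : X × X => K p.1 p.2)
    (hE : IsEigensystem K P lam φ) (hS : Summable fun k => lam k * ‖φ k‖ ^ 2) {x y : X}
    (hx : x ∈ P.support) (hy : y ∈ P.support) : K x y = tailKernel lam φ 0 x y := by
  have hT := continuous_tailKernel (φ := φ) hE.nonneg hS 0
  set D : X → X → ℝ := fun x y => K x y - tailKernel lam φ 0 x y with hDdef
  have hD : Continuous fun p : X × X => D p.1 p.2 := hK.sub hT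
  have hDx : ∀ x, Continuous (D x) := fun x => hD.comp (Continuous.prodMk_right x)
  have hKx : ∀ x, Continuous (K x) := fun x => hK.comp (Continuous.prodMk_right x)
  have hTx : ∀ x, Continuous (tailKernel lam φ 0 x) := fun x => hT.comp (Continuous.prodMk_right x)
  have horth : ∀ x k, ∫ y, D x y * φ k y ∂P = 0 := fun x k => by
    have h1 := hE.eigen k x
    have h2 := integral_tailKernel_mul_eigenfunction hE hS 0 k x
    rw [zero_add] at h2
    have hc := (φ k).continuous
    simp only [hDdef, sub_mul]
    refine (integral_sub (integrable_of_continuous ((hKx x).mul hc))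
      (integrable_of_continuous ((hTx x).mul hc))).trans (sub_eq_zero.mpr ?_)
    exact h1.trans h2.symm
  -- `D x` is orthogonal to every `φ k`. So `T_K` annihilates it almost everywhere by
  -- exhaustiveness, and the operator with the series as kernel does so term by term.
  have hDD : ∀ x, ∀ᵐ z ∂P, ∫ y, D z y * D x y ∂P = 0 := fun x => by
    have hmem : MemLp (D x) 2 P :=
      (hDx x).memLp_of_hasCompactSupport (HasCompactSupport.of_compactSpace _)
    filter_upwards [hE.exhaustive (D x) hmem (horth x)] with z hz
    have h0 := hasSum_integral_tailKernel_mul (P := P) hE.nonneg hS 0 z ⟨D x, hDx x⟩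
    have h0' : ∫ y, tailKernel lam φ 0 z y * D x y ∂P = 0 := by
      refine h0.unique ?_
      simp only [ContinuousMap.coe_mk, mul_comm (φ _ _) (D x _), horth, mul_zero]
      exact hasSum_zero
    have e : ∀ y, D z y * D x y = K z y * D x y - tailKernel lam φ 0 z y * D x y :=
      fun y => sub_mul _ _ _
    simp only [e]
    refine (integral_sub (integrable_of_continuous ((hKx z).mul (hDx x)))
      (integrable_of_continuous ((hTx z).mul (hDx x)))).trans (sub_eq_zero.mpr ?_)
    exact hz.trans h0'.symm
  -- Continuity in `z` upgrades the almost everywhere identity to all `z` in the support. At `z = x`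
  -- it says that `D x` has zero `L²` norm.
  have hcont : Continuous fun z => ∫ y, D z y * D x y ∂P := by
    have h : Continuous (Function.uncurry fun z y => D z y * D x y) :=
      hD.mul ((hDx x).comp continuous_snd)
    simpa using continuous_parametric_integral_of_continuous (μ := P) h isCompact_univ
  have hxx : ∫ y, D x y * D x y ∂P = 0 :=
    eq_zero_of_ae_eq_zero_of_mem_support hcont (hDD x) hx
  have hae : (fun y => D x y * D x y) =ᵐ[P] 0 :=
    (integral_eq_zero_iff_of_nonneg (fun y => mul_self_nonneg _)
      (integrable_of_continuous ((hDx x).mul (hDx x)))).mp hxx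
  have hae' : ∀ᵐ y ∂P, D x y = 0 := by
    filter_upwards [hae] with y h using mul_self_eq_zero.mp h
  exact sub_eq_zero.mp (eq_zero_of_ae_eq_zero_of_mem_support (hDx x) hae' hy)

theorem kernel_sub_truncKernel (hK : Continuous fun p : X × X => K p.1 p.2)
    (hE : IsEigensystem K P lam φ) (hS : Summable fun k => lam k * ‖φ k‖ ^ 2) (N : ℕ) {x y : X}
    (hx : x ∈ P.support) (hy : y ∈ P.support) :
    K x y - truncKernel lam φ N x y = tailKernel lam φ N x y := by
  rw [kernel_eq_tailKernel_zero hK hE hS hx hy, ← truncKernel_add_tailKernel hE.nonneg hS N,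
    add_sub_cancel_left]

theorem tailKernel_self_le (hK : Continuous fun p : X × X => K p.1 p.2)
    (hE : IsEigensystem K P lam φ) (hS : Summable fun k => lam k * ‖φ k‖ ^ 2) (N : ℕ) {x : X}
    (hx : x ∈ P.support) : tailKernel lam φ N x x ≤ K x x := by
  have h := kernel_sub_truncKernel hK hE hS N hx hx
  have := truncKernel_self_nonneg (φ := φ) hE.nonneg N x
  linarith

/-- The eigenvalue bound `N λ_N ≤ κ`. -/
theorem mul_eigenvalue_le (hK : Continuous fun p : X × X => K p.1 p.2)
    {κ : ℝ} (hκ : ∀ x, K x x ≤ κ)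
    (hE : IsEigensystem K P lam φ) (hS : Summable fun k => lam k * ‖φ k‖ ^ 2) (N : ℕ) :
    N * lam N ≤ κ := by
  -- Indices start at `0`: `lam N` is dominated by each of the `N` eigenvalues before it, and their
  -- sum is the integral of the diagonal of `K_N`, which is at most `κ` on the support.
  have h1 : ∑ k ∈ Finset.range N, lam N ≤ ∑ k ∈ Finset.range N, lam k :=
    Finset.sum_le_sum fun k hk => hE.antitone (Finset.mem_range.mp hk).le
  have h2 : ∫ x, truncKernel lam φ N x x ∂P ≤ ∫ _, κ ∂P := by
    refine integral_mono_ae (integrable_of_continuous ?_) (integrable_const _) ?_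
    · simp only [truncKernel]; fun_prop
    · filter_upwards [P.support_mem_ae] with x hx
      have h := kernel_sub_truncKernel hK hE hS N hx hx
      have := tailKernel_self_nonneg (φ := φ) hE.nonneg N x
      linarith [hκ x]
  rw [integral_truncKernel_self hE] at h2
  simp at h1 h2
  linarith

end Mercer

/-! ### Spectral truncation error in the RKHS -/

section Approximation

variable {X : Type*} [TopologicalSpace X] [MeasurableSpace X] {P : Measure X} {K : X → X → ℝ}
  {lam : ℕ → ℝ} {φ : ℕ → C(X, ℝ)} {f : X → ℝ}

theorem continuous_eigenProj (N : ℕ) : Continuous (eigenProj P φ N f) := by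
  unfold eigenProj; fun_prop

theorem ofReal_coeff_sq_le (hE : IsEigensystem K P lam φ) (hfin : rkhsNormSq P lam φ f < ∞)
    (N k : ℕ) : ENNReal.ofReal (coeff P φ f (N + k) ^ 2) ≤ ENNReal.ofReal (lam N) *
      (ENNReal.ofReal (coeff P φ f (N + k) ^ 2) / ENNReal.ofReal (lam (N + k))) := by
  have hlt := (ENNReal.le_tsum (f := fun k => ENNReal.ofReal (coeff P φ f k ^ 2) /
    ENNReal.ofReal (lam k)) (N + k)).trans_lt hfin
  -- At a zero eigenvalue, finiteness of the RKHS norm forces the coefficient to vanish.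
  rcases (hE.nonneg (N + k)).eq_or_lt with h0 | h0
  · have : ENNReal.ofReal (coeff P φ f (N + k) ^ 2) = 0 := by
      by_contra hne
      simp [← h0, ENNReal.div_zero hne] at hlt
    simp [this]
  · calc ENNReal.ofReal (coeff P φ f (N + k) ^ 2)
        = ENNReal.ofReal (lam (N + k)) *
          (ENNReal.ofReal (coeff P φ f (N + k) ^ 2) / ENNReal.ofReal (lam (N + k))) :=
          (ENNReal.mul_div_cancel (by simpa using h0) ENNReal.ofReal_ne_top).symm
      _ ≤ _ := by
          gcongr
          exact hE.antitone (Nat.le_add_right N k)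

variable [CompactSpace X] [BorelSpace X] [IsProbabilityMeasure P]

theorem memLp_two_of_continuous {g : X → ℝ} (hg : Continuous g) : MemLp g 2 P :=
  hg.memLp_of_hasCompactSupport (HasCompactSupport.of_compactSpace _)

theorem integral_residual_mul_eigenfunction (hE : IsEigensystem K P lam φ) (hf : MemLp f 2 P)
    (N : ℕ) : ∫ x, (f x - eigenProj P φ N f x) * φ N x ∂P = coeff P φ f N := by
  have h1 : Integrable (fun x => f x * φ N x) P :=
    hf.integrable_mul (memLp_two_of_continuous (φ N).continuous)
  have h2 : ∫ x, eigenProj P φ N f x * φ N x ∂P = 0 := by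
    simp only [eigenProj, Finset.sum_mul]
    rw [integral_finsetSum _ fun k _ => integrable_of_continuous (by fun_prop)]
    refine Finset.sum_eq_zero fun k hk => ?_
    simp only [mul_assoc]
    rw [integral_const_mul, hE.orthonormal, if_neg (Finset.mem_range.mp hk).ne, mul_zero]
  have h3 : Integrable (fun x => eigenProj P φ N f x * φ N x) P :=
    integrable_of_continuous ((continuous_eigenProj N).mul (φ N).continuous)
  simp only [sub_mul]
  rw [integral_sub h1 h3, h2, sub_zero, coeff]

/-- Pythagoras: consecutive residuals differ by `a_N φ_N`, and the earlier one has inner product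
`a_N` with `φ_N`. -/
theorem integral_residual_sq_succ (hE : IsEigensystem K P lam φ) (hf : MemLp f 2 P) (N : ℕ) :
    ∫ x, (f x - eigenProj P φ N f x) ^ 2 ∂P
      = ∫ x, (f x - eigenProj P φ (N + 1) f x) ^ 2 ∂P + coeff P φ f N ^ 2 := by
  have hg : MemLp (fun x => f x - eigenProj P φ N f x) 2 P :=
    hf.sub (memLp_two_of_continuous (continuous_eigenProj N))
  have hφ : MemLp (φ N) 2 P := memLp_two_of_continuous (φ N).continuous
  have e : ∀ x, (f x - eigenProj P φ (N + 1) f x) ^ 2 = (f x - eigenProj P φ N f x) ^ 2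
      - 2 * coeff P φ f N * ((f x - eigenProj P φ N f x) * φ N x)
      + coeff P φ f N ^ 2 * (φ N x * φ N x) := fun x => by
    simp only [eigenProj, Finset.sum_range_succ]; ring
  simp only [e]
  have i1 := hg.integrable_sq
  have i2 : Integrable (fun x => 2 * coeff P φ f N * ((f x - eigenProj P φ N f x) * φ N x)) P :=
    (hg.integrable_mul hφ).const_mul _
  have i3 : Integrable (fun x => coeff P φ f N ^ 2 * (φ N x * φ N x)) P :=
    integrable_of_continuous (by fun_prop)
  have i12 : Integrable (fun x => (f x - eigenProj P φ N f x) ^ 2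
      - 2 * coeff P φ f N * ((f x - eigenProj P φ N f x) * φ N x)) P := i1.sub i2
  rw [integral_add i12 i3, integral_sub i1 i2, integral_const_mul, integral_const_mul,
    integral_residual_mul_eigenfunction hE hf, hE.orthonormal, if_pos rfl]
  ring

theorem integral_residual_sq_add (hE : IsEigensystem K P lam φ) (hf : MemLp f 2 P) (N m : ℕ) :
    ∫ x, (f x - eigenProj P φ N f x) ^ 2 ∂P
      = ∫ x, (f x - eigenProj P φ (N + m) f x) ^ 2 ∂P
        + ∑ k ∈ Finset.range m, coeff P φ f (N + k) ^ 2 := by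
  induction m with
  | zero => simp
  | succ m ih =>
    rw [ih, integral_residual_sq_succ hE hf (N + m), Finset.sum_range_succ, add_assoc N m 1]
    ring

/-- The spectral truncation error of an element of the RKHS. -/
theorem lintegral_residual_sq_le (hE : IsEigensystem K P lam φ) (hf : MemRKHS P lam φ f) (N : ℕ) :
    ∫⁻ x, ENNReal.ofReal ((f x - eigenProj P φ N f x) ^ 2) ∂P
      ≤ ENNReal.ofReal (lam N) * rkhsNormSq P lam φ f := by
  have hg : MemLp (fun x => f x - eigenProj P φ N f x) 2 P :=
    hf.memLp.sub (memLp_two_of_continuous (continuous_eigenProj N))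
  rw [← ofReal_integral_eq_lintegral_ofReal hg.integrable_sq
    (Eventually.of_forall fun x => sq_nonneg _)]
  have hne : ENNReal.ofReal (lam N) * rkhsNormSq P lam φ f ≠ ∞ :=
    ENNReal.mul_ne_top ENNReal.ofReal_ne_top hf.norm_lt_top.ne
  refine ENNReal.ofReal_le_of_le_toReal ?_
  have hsum : ∀ m, ∑ k ∈ Finset.range m, coeff P φ f (N + k) ^ 2
      ≤ (ENNReal.ofReal (lam N) * rkhsNormSq P lam φ f).toReal := fun m => by
    rw [← ENNReal.ofReal_le_iff_le_toReal hne,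
      ENNReal.ofReal_sum_of_nonneg fun k _ => sq_nonneg _]
    calc ∑ k ∈ Finset.range m, ENNReal.ofReal (coeff P φ f (N + k) ^ 2)
        ≤ ∑ k ∈ Finset.range m, ENNReal.ofReal (lam N) *
          (ENNReal.ofReal (coeff P φ f (N + k) ^ 2) / ENNReal.ofReal (lam (N + k))) :=
          Finset.sum_le_sum fun k _ => ofReal_coeff_sq_le hE hf.norm_lt_top N k
      _ ≤ _ := by
          rw [← Finset.mul_sum]
          gcongr
          exact (ENNReal.sum_le_tsum _).trans (ENNReal.tsum_comp_le_tsum_of_injective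
            (add_right_injective N) fun k => ENNReal.ofReal (coeff P φ f k ^ 2) /
              ENNReal.ofReal (lam k))
  -- The remainder after `N + m` terms tends to `0` because `f` is the sum of its expansion, so the
  -- uniform bound on the partial sums passes to the full residual.
  have hlim := (hf.expansion.comp (tendsto_add_atTop_nat N)).add_const
    (ENNReal.ofReal (lam N) * rkhsNormSq P lam φ f).toReal
  rw [zero_add] at hlim
  refine ge_of_tendsto' hlim fun m => ?_
  rw [integral_residual_sq_add hE hf.memLp N m, Function.comp_apply, add_comm m N]
  gcongr
  exact hsum m

end Approximation

/-! ### Change of measure under a bounded density -/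

section Density

variable {X : Type*} [MeasurableSpace X] {P ρ : Measure X} [IsProbabilityMeasure P]
  [IsProbabilityMeasure ρ]

/-- The measures themselves compare, `ρ ≤ B • P`, so `g` need not be measurable. -/
theorem lintegral_le_mul_of_rnDeriv_le (hac : ρ ≪ P) {B : ℝ≥0}
    (hB : ∀ᵐ x ∂P, ρ.rnDeriv P x ≤ (B : ℝ≥0∞)) (g : X → ℝ≥0∞) :
    ∫⁻ x, g x ∂ρ ≤ B * ∫⁻ x, g x ∂P := by
  have h : ρ ≤ (B : ℝ≥0∞) • P := by
    rw [← Measure.withDensity_rnDeriv_eq ρ P hac, ← withDensity_const]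
    exact withDensity_mono hB
  refine (lintegral_mono' h le_rfl).trans ?_
  rw [lintegral_smul_measure, smul_eq_mul]

end Density

/-! ### Second moment of a linear combination of the noise -/

section Noise

variable {Ω : Type*} [MeasurableSpace Ω] {μ : Measure Ω} [IsProbabilityMeasure μ] {n : ℕ} {σ : ℝ}
  {ε : Fin n → Ω → ℝ}

theorem lintegral_add_noise_sq (hind : iIndepFun ε μ) (h2 : ∀ i, MemLp (ε i) 2 μ)
    (h0 : ∀ i, ∫ ω, ε i ω ∂μ = 0) (hσ : ∀ i, ∫ ω, ε i ω ^ 2 ∂μ = σ ^ 2) (c : ℝ) (m : Fin n → ℝ) :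
    ∫⁻ ω, ENNReal.ofReal ((c + ∑ l, m l * ε l ω) ^ 2) ∂μ
      = ENNReal.ofReal (c ^ 2 + σ ^ 2 * ∑ l, m l ^ 2) := by
  set η : Ω → ℝ := ∑ l, fun ω => m l * ε l ω with hη
  have hml : ∀ l, MemLp (fun ω => m l * ε l ω) 2 μ := fun l => (h2 l).const_mul _
  have hηL : MemLp η 2 μ := memLp_finsetSum' _ fun l _ => hml l
  have hmean : ∫ ω, η ω ∂μ = 0 := by
    simp only [hη, Finset.sum_apply]
    rw [integral_finsetSum _ fun l _ => (hml l).integrable (by norm_num)]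
    exact Finset.sum_eq_zero fun l _ => by rw [integral_const_mul, h0, mul_zero]
  have hvarε : ∀ l, variance (fun ω => m l * ε l ω) μ = m l ^ 2 * σ ^ 2 := fun l => by
    rw [variance_const_mul, variance_of_integral_eq_zero (h2 l).aemeasurable (h0 l), hσ]
  have hsq : ∫ ω, η ω ^ 2 ∂μ = σ ^ 2 * ∑ l, m l ^ 2 := by
    rw [← variance_of_integral_eq_zero hηL.aemeasurable hmean, hη,
      IndepFun.variance_sum (fun l _ => hml l) fun i _ j _ hij =>
        (hind.indepFun hij).comp (measurable_const_mul (m i)) (measurable_const_mul (m j)),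
      Finset.mul_sum]
    exact Finset.sum_congr rfl fun l _ => by rw [hvarε, mul_comm]
  have hint : Integrable (fun ω => (c + η ω) ^ 2) μ :=
    ((memLp_const c).add hηL).integrable_sq
  have e : ∀ ω, c + ∑ l, m l * ε l ω = c + η ω := fun ω => by simp [hη]
  simp only [e]
  rw [← ofReal_integral_eq_lintegral_ofReal hint (Eventually.of_forall fun ω => sq_nonneg _)]
  congr 1
  have e' : ∀ ω, (c + η ω) ^ 2 = c ^ 2 + 2 * c * η ω + η ω ^ 2 := fun ω => by ring
  have i1 : Integrable η μ := hηL.integrable (by norm_num)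
  have i2 : Integrable (fun ω => 2 * c * η ω) μ := i1.const_mul _
  have i3 : Integrable (fun ω => c ^ 2 + 2 * c * η ω) μ := (integrable_const _).add i2
  simp only [e']
  rw [integral_add i3 hηL.integrable_sq, integral_add (integrable_const _) i2, integral_const_mul,
    hmean, hsq]
  simp

end Noise

/-! ### Empirical bias at a fixed sample -/

section Deterministic

open Matrix

variable {X : Type*} {K : X → X → ℝ} {n N : ℕ} {hN : N ≤ n} {r : ℝ}

theorem kernelComb_eq_gram_mulVec (hsymm : ∀ x y, K x y = K y x) (x : Fin n → X) (w : Fin N → ℝ)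
    (i : Fin n) : kernelComb K hN x w (x i) = (gram K hN x *ᵥ w) i := by
  simp only [kernelComb, mulVec, dotProduct, gram, of_apply]
  exact Finset.sum_congr rfl fun j _ => by rw [hsymm (x i), mul_comm]

/-- The residual `(A (Aᵀ A + r)⁻¹ Aᵀ - 1) f` of ridge regression on noiseless data. -/
noncomputable def bias (K : X → X → ℝ) (hN : N ≤ n) (r : ℝ) (f : X → ℝ) (x : Fin n → X) :
    Fin n → ℝ :=
  hatMatrix (gram K hN x) r *ᵥ (fun l => f (x l)) - fun l => f (x l)

theorem empError_eq (hsymm : ∀ x y, K x y = K y x) (f : X → ℝ) (x : Fin n → X) (e : Fin n → ℝ) :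
    empError K hN r f x e = 1 / (n : ℝ) *
      ∑ i, (bias K hN r f x i + ∑ l, hatMatrix (gram K hN x) r i l * e l) ^ 2 := by
  unfold empError
  congr 1
  refine Finset.sum_congr rfl fun i _ => ?_
  have h : estimator K hN r x (fun l => f (x l) + e l) (x i)
      = (hatMatrix (gram K hN x) r *ᵥ ((fun l => f (x l)) + e)) i := by
    rw [estimator, kernelComb_eq_gram_mulVec hsymm, hatMatrix_mulVec]
    rfl
  rw [h, mulVec_add, bias]
  simp only [Pi.add_apply, Pi.sub_apply, mulVec, dotProduct]
  ring

/-- The coefficients `w` represent `g` in the kernel `KN` but serve as comparison vector for `K`;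
the mismatch is `(1/n) ∑ w_j R(x_j, ·)`. The identity `K - KN = R` is asked only at sample points,
since the Mercer expansion is available only on the support. -/
theorem empiricalBias_le (hsymm : ∀ x y, K x y = K y x) (hr : 0 < r) (hn : 0 < n) {f g : X → ℝ}
    {KN R : X → X → ℝ} {x : Fin n → X} {w : Fin N → ℝ} (hg : ∀ z, g z = kernelComb KN hN x w z)
    (hR : ∀ i j, K (x i) (x j) - KN (x i) (x j) = R (x i) (x j))
    (hw : 1 / (n : ℝ) * ∑ j, w j ^ 2 ≤ 1) :
    1 / (n : ℝ) * ∑ i, bias K hN r f x i ^ 2 ≤ r / 2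
      + 4 / (n : ℝ) * ∑ i, (f (x i) - g (x i)) ^ 2
      + 4 / (n : ℝ) ^ 2 * ∑ i, ∑ j : Fin N, R (x (Fin.castLE hN j)) (x i) ^ 2 := by
  have hn' : (0 : ℝ) < n := by exact_mod_cast hn
  have h := hatMatrix_bias_le (gram K hN x) hr (fun l => f (x l)) w
  have hw' : ∑ j, w j ^ 2 ≤ n := by
    rw [one_div, inv_mul_le_iff₀ hn'] at hw
    simpa using hw
  have hres : ∀ i, (f (x i) - (gram K hN x *ᵥ w) i) ^ 2 ≤ 2 * (f (x i) - g (x i)) ^ 2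
      + 2 / (n : ℝ) * ∑ j : Fin N, R (x (Fin.castLE hN j)) (x i) ^ 2 := fun i => by
    set q := ∑ j, w j * (1 / (n : ℝ) * R (x (Fin.castLE hN j)) (x i)) with hq
    have e : f (x i) - (gram K hN x *ᵥ w) i = (f (x i) - g (x i)) - q := by
      rw [← kernelComb_eq_gram_mulVec hsymm, hg, hq]
      have : ∑ j, w j * (1 / (n : ℝ) * R (x (Fin.castLE hN j)) (x i))
          = kernelComb K hN x w (x i) - kernelComb KN hN x w (x i) := by
        simp only [kernelComb, ← Finset.sum_sub_distrib, ← hR]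
        exact Finset.sum_congr rfl fun j _ => by ring
      rw [this]; ring
    -- Cauchy-Schwarz with `∑ w_j² ≤ n`: one of the two factors `1/n` is absorbed.
    have hq2 : q ^ 2 ≤ 1 / (n : ℝ) * ∑ j : Fin N, R (x (Fin.castLE hN j)) (x i) ^ 2 := by
      have hR0 : 0 ≤ ∑ j : Fin N, R (x (Fin.castLE hN j)) (x i) ^ 2 :=
        Finset.sum_nonneg fun j _ => sq_nonneg _
      calc q ^ 2 ≤ (∑ j, w j ^ 2) * ∑ j : Fin N, (1 / (n : ℝ) * R (x (Fin.castLE hN j)) (x i)) ^ 2 :=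
            Finset.sum_mul_sq_le_sq_mul_sq _ _ _
        _ ≤ n * ∑ j : Fin N, (1 / (n : ℝ) * R (x (Fin.castLE hN j)) (x i)) ^ 2 := by gcongr
        _ = _ := by
            simp only [mul_pow, ← Finset.mul_sum]
            field_simp
    rw [e]
    have : 2 / (n : ℝ) * ∑ j : Fin N, R (x (Fin.castLE hN j)) (x i) ^ 2
      = 2 * (1 / (n : ℝ) * ∑ j : Fin N, R (x (Fin.castLE hN j)) (x i) ^ 2) := by ring
    rw [this]
    nlinarith [sq_nonneg (f (x i) - g (x i) + q)]
  have hsum := Finset.sum_le_sum fun i (_ : i ∈ Finset.univ) => hres i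
  rw [Finset.sum_add_distrib, ← Finset.mul_sum, ← Finset.mul_sum] at hsum
  simp only [dotProduct, ← sq, Pi.sub_apply] at h
  have hb : ∑ i, bias K hN r f x i ^ 2 ≤ 2 * (2 * ∑ i, (f (x i) - g (x i)) ^ 2
      + 2 / (n : ℝ) * ∑ i, ∑ j : Fin N, R (x (Fin.castLE hN j)) (x i) ^ 2) + r / 2 * n := by
    refine h.trans ?_
    gcongr
  calc 1 / (n : ℝ) * ∑ i, bias K hN r f x i ^ 2
      ≤ 1 / (n : ℝ) * (2 * (2 * ∑ i, (f (x i) - g (x i)) ^ 2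
      + 2 / (n : ℝ) * ∑ i, ∑ j : Fin N, R (x (Fin.castLE hN j)) (x i) ^ 2) + r / 2 * n) := by
        gcongr
    _ = _ := by field_simp; ring

end Deterministic

/-! ### Expectation over the noise and over the sample -/

section Risk

variable {X : Type*} {K : X → X → ℝ} {f : X → ℝ} {n N : ℕ} {hN : N ≤ n} {r : ℝ}
  {Ω : Type*} [MeasurableSpace Ω] {μ : Measure Ω}
  {S : Fin n → Ω → X} {σ : ℝ} {ε : Fin n → Ω → ℝ}

theorem lintegral_empError [IsProbabilityMeasure μ] (hsymm : ∀ x y, K x y = K y x) (hr : 0 < r)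
    (hεm : ∀ i, Measurable (ε i)) (hind : iIndepFun ε μ) (h2 : ∀ i, MemLp (ε i) 2 μ)
    (h0 : ∀ i, ∫ ω, ε i ω ∂μ = 0) (hσ : ∀ i, ∫ ω, ε i ω ^ 2 ∂μ = σ ^ 2) (x : Fin n → X) :
    ∫⁻ ω, ENNReal.ofReal (empError K hN r f x (fun i => ε i ω)) ∂μ
      = ENNReal.ofReal (1 / (n : ℝ) * ∑ i, bias K hN r f x i ^ 2)
        + ENNReal.ofReal (σ ^ 2 / n) *
          ∑ j : Fin N, ENNReal.ofReal ((mu K hN x j ^ 2 / (mu K hN x j ^ 2 + r)) ^ 2) := by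
  have hn : 0 ≤ 1 / (n : ℝ) := by positivity
  simp only [empError_eq hsymm, ENNReal.ofReal_mul hn,
    ENNReal.ofReal_sum_of_nonneg fun i _ => sq_nonneg _]
  rw [lintegral_const_mul' _ _ ENNReal.ofReal_ne_top,
    lintegral_finsetSum _ fun i _ => (by fun_prop)]
  simp only [lintegral_add_noise_sq hind h2 h0 hσ]
  rw [← ENNReal.ofReal_sum_of_nonneg fun i _ => by positivity,
    ← ENNReal.ofReal_sum_of_nonneg fun i _ => by positivity,
    ← ENNReal.ofReal_sum_of_nonneg fun i _ => by positivity, ← ENNReal.ofReal_mul hn,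
    ← ENNReal.ofReal_mul hn, ← ENNReal.ofReal_mul (by positivity),
    ← ENNReal.ofReal_add (by positivity) (by positivity)]
  congr 1
  rw [Finset.sum_add_distrib, ← Finset.mul_sum, sum_sq_hatMatrix _ hr]
  simp only [mu]
  ring

theorem IsMercerKernel.symm [TopologicalSpace X] (hK : IsMercerKernel K) (x y : X) :
    K x y = K y x := by
  simpa using (hK.posSemidef.isHermitian.apply x y).symm

/-- Of the `n N` pairs only `N` are diagonal. The sum is `N κ B + n N B² a`; now use `N a ≤ κ` and
`N ≤ n`. -/
theorem sum_pair_coefficient_le {κ B a : ℝ} (hκ : 0 ≤ κ) (hB : 0 ≤ B) (ha : N * a ≤ κ)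
    (hN0 : 0 < N) (hN : N ≤ n) :
    4 / (n : ℝ) ^ 2 * ∑ i : Fin n, ∑ j : Fin N,
      ((if Fin.castLE hN j = i then κ * B else 0) + B ^ 2 * a)
      ≤ (4 * κ * B + 4 * κ * B ^ 2) * (N : ℝ)⁻¹ := by
  have hN' : (0 : ℝ) < N := by exact_mod_cast hN0
  have hn' : (0 : ℝ) < n := by exact_mod_cast hN0.trans_le hN
  have hNn : (N : ℝ) ≤ n := by exact_mod_cast hN
  have e : ∑ i : Fin n, ∑ j : Fin N, ((if Fin.castLE hN j = i then κ * B else 0) + B ^ 2 * a)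
      = N * (κ * B) + n * N * (B ^ 2 * a) := by
    rw [Finset.sum_comm]
    simp [Finset.sum_add_distrib]
    ring
  rw [e, div_mul_eq_mul_div, div_le_iff₀ (by positivity), ← sub_nonneg]
  have h1 : B ^ 2 * (N * a) ≤ B ^ 2 * κ := by gcongr
  have e2 : (4 * κ * B + 4 * κ * B ^ 2) * (N : ℝ)⁻¹ * n ^ 2
      - 4 * (N * (κ * B) + n * N * (B ^ 2 * a))
      = (4 * κ * B * (n ^ 2 - N ^ 2) + 4 * n * (B ^ 2 * κ * (n - N) +
        N * (B ^ 2 * κ - B ^ 2 * (N * a)))) * (N : ℝ)⁻¹ := by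
    field_simp
    ring
  rw [e2]
  have h2 : (0 : ℝ) ≤ n ^ 2 - N ^ 2 := by nlinarith
  have h3 : (0 : ℝ) ≤ n - N := by linarith
  have h4 : 0 ≤ B ^ 2 * κ - B ^ 2 * (N * a) := by linarith
  positivity

variable [TopologicalSpace X] [MeasurableSpace X] {P ρ : Measure X} {lam : ℕ → ℝ}
  {φ : ℕ → C(X, ℝ)}

section Measurability

variable [BorelSpace X] [SecondCountableTopology X]

theorem measurable_empError (hsymm : ∀ x y, K x y = K y x)
    (hK : Continuous fun p : X × X => K p.1 p.2) (hr : 0 < r) (hf : Measurable f) :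
    Measurable fun p : (Fin n → X) × (Fin n → ℝ) => empError K hN r f p.1 p.2 := by
  have hM : ∀ i l, Measurable fun x : Fin n → X => hatMatrix (gram K hN x) r i l := fun i l =>
    ((continuous_hatMatrix_gram hK hN hr).matrix_elem i l).measurable
  have hb : ∀ i, Measurable fun x : Fin n → X => bias K hN r f x i := fun i => by
    simp only [bias, Pi.sub_apply, Matrix.mulVec, dotProduct]
    fun_prop
  simp only [empError_eq hsymm]
  exact (Finset.measurable_sum _ fun i _ => (((hb i).comp measurable_fst).add
    (Finset.measurable_sum _ fun l _ => ((hM i l).comp measurable_fst).mul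
      ((measurable_pi_apply l).comp measurable_snd))).pow_const 2).const_mul _

/-- The expected empirical error splits into bias and variance. -/
theorem setLIntegral_empError [IsProbabilityMeasure μ] (hsymm : ∀ x y, K x y = K y x)
    (hK : Continuous fun p : X × X => K p.1 p.2) (hr : 0 < r) (hf : Measurable f)
    (hSm : ∀ i, Measurable (S i)) (hεm : ∀ i, Measurable (ε i)) (hind : iIndepFun ε μ)
    (h2 : ∀ i, MemLp (ε i) 2 μ) (h0 : ∀ i, ∫ ω, ε i ω ∂μ = 0)
    (hσ : ∀ i, ∫ ω, ε i ω ^ 2 ∂μ = σ ^ 2)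
    (hSε : IndepFun (fun ω i => S i ω) (fun ω i => ε i ω) μ) {G : Set (Fin n → X)}
    (hG : MeasurableSet G) :
    ∫⁻ ω in {ω | (fun i => S i ω) ∈ G}, ENNReal.ofReal
        (empError K hN r f (fun i => S i ω) (fun i => ε i ω)) ∂μ
      = ∫⁻ ω in {ω | (fun i => S i ω) ∈ G},
        (ENNReal.ofReal (1 / (n : ℝ) * ∑ i, bias K hN r f (fun i => S i ω) i ^ 2)
        + ENNReal.ofReal (σ ^ 2 / n) * ∑ j : Fin N, ENNReal.ofReal
          ((mu K hN (fun i => S i ω) j ^ 2 / (mu K hN (fun i => S i ω) j ^ 2 + r)) ^ 2)) ∂μ := by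
  have hS : Measurable fun ω i => S i ω := measurable_pi_lambda _ hSm
  have hε : Measurable fun ω i => ε i ω := measurable_pi_lambda _ hεm
  have hF : Measurable fun p : (Fin n → X) × (Fin n → ℝ) =>
      ENNReal.ofReal (empError K hN r f p.1 p.2) :=
    (measurable_empError hsymm hK hr hf).ennreal_ofReal
  have hprod := hSε.map_prod_eq_prod_map_map hS.aemeasurable hε.aemeasurable
  have : IsProbabilityMeasure (μ.map fun ω i => S i ω) :=
    Measure.isProbabilityMeasure_map hS.aemeasurable
  have : IsProbabilityMeasure (μ.map fun ω i => ε i ω) :=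
    Measure.isProbabilityMeasure_map hε.aemeasurable
  have hset : {ω | (fun i => S i ω) ∈ G}
      = (fun ω => ((fun i => S i ω), (fun i => ε i ω))) ⁻¹' (G ×ˢ Set.univ) := by
    ext ω; simp
  have h1 := setLIntegral_map (μ := μ) (hG.prod MeasurableSet.univ) hF (hS.prodMk hε)
  -- By independence the joint law is a product and `G` constrains only its first factor, so the
  -- noise can be integrated out at a fixed sample.
  rw [hset, ← h1, hprod, ← Measure.prod_restrict, Measure.restrict_univ,
    lintegral_prod _ hF.aemeasurable,
    setLIntegral_map hG hF.lintegral_prod_right' hS, ← hset]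
  refine lintegral_congr fun ω => ?_
  refine (lintegral_map (hF.comp measurable_prodMk_left) hε).trans ?_
  exact lintegral_empError hsymm hr hεm hind h2 h0 hσ _

end Measurability

variable [CompactSpace X]

theorem summable_of_tsum_ne_top (hE : IsEigensystem K P lam φ) (N : ℕ)
    (h : ∑' k, ENNReal.ofReal (lam (N + k) * ‖φ (N + k)‖ ^ 2) ≠ ∞) :
    Summable fun k => lam k * ‖φ k‖ ^ 2 := by
  have hs := ENNReal.summable_toReal h
  have e : ∀ k, (ENNReal.ofReal (lam (N + k) * ‖φ (N + k)‖ ^ 2)).toReal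
      = lam (k + N) * ‖φ (k + N)‖ ^ 2 := fun k => by
    rw [ENNReal.toReal_ofReal (mul_nonneg (hE.nonneg _) (sq_nonneg _)), add_comm]
  simp only [e] at hs
  exact (summable_nat_add_iff N).mp hs

variable [BorelSpace X] [IsProbabilityMeasure P] [IsProbabilityMeasure ρ]

theorem lintegral_residual_sample_le (hE : IsEigensystem K P lam φ) (hac : ρ ≪ P) {B : ℝ≥0}
    (hB : ∀ᵐ x ∂P, ρ.rnDeriv P x ≤ (B : ℝ≥0∞)) (hfm : Measurable f) (hf : MemRKHS P lam φ f)
    (hSm : ∀ i, Measurable (S i)) (hlaw : ∀ i, μ.map (S i) = ρ) (N : ℕ) (i : Fin n) :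
    ∫⁻ ω, ENNReal.ofReal ((f (S i ω) - eigenProj P φ N f (S i ω)) ^ 2) ∂μ
      ≤ B * (ENNReal.ofReal (lam N) * rkhsNormSq P lam φ f) := by
  have hm : Measurable fun x => ENNReal.ofReal ((f x - eigenProj P φ N f x) ^ 2) :=
    ((hfm.sub (continuous_eigenProj N).measurable).pow_const 2).ennreal_ofReal
  rw [← lintegral_map hm (hSm i), hlaw]
  refine (lintegral_le_mul_of_rnDeriv_le hac hB _).trans ?_
  gcongr
  exact lintegral_residual_sq_le hE hf N

theorem lintegral_tailKernel_self_sample_le (hE : IsEigensystem K P lam φ)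
    (hS : Summable fun k => lam k * ‖φ k‖ ^ 2) (hac : ρ ≪ P) {B : ℝ≥0}
    (hB : ∀ᵐ x ∂P, ρ.rnDeriv P x ≤ (B : ℝ≥0∞)) (N : ℕ) :
    ∫⁻ x, ENNReal.ofReal (tailKernel lam φ N x x) ∂ρ
      ≤ B * ∑' k, ENNReal.ofReal (lam (N + k) * ‖φ (N + k)‖ ^ 2) := by
  refine (lintegral_le_mul_of_rnDeriv_le hac hB _).trans ?_
  gcongr
  exact lintegral_tailKernel_self_le hE hS N

variable [SecondCountableTopology X]

/-- Each variable costs one density factor `B`. The inner integral is at most `B λ_{N+1} R(x, x)`,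
and the outer one integrates the diagonal. -/
theorem lintegral_tailKernel_sq_prod_le (hE : IsEigensystem K P lam φ)
    (hS : Summable fun k => lam k * ‖φ k‖ ^ 2) (hac : ρ ≪ P) {B : ℝ≥0}
    (hB : ∀ᵐ x ∂P, ρ.rnDeriv P x ≤ (B : ℝ≥0∞)) (N : ℕ) :
    ∫⁻ p : X × X, ENNReal.ofReal (tailKernel lam φ N p.1 p.2 ^ 2) ∂(ρ.prod ρ)
      ≤ ENNReal.ofReal (B ^ 2 * lam N) *
        ∑' k, ENNReal.ofReal (lam (N + k) * ‖φ (N + k)‖ ^ 2) := by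
  have hc := continuous_tailKernel (φ := φ) hE.nonneg hS N
  have hx : ∀ x, ∫⁻ y, ENNReal.ofReal (tailKernel lam φ N x y ^ 2) ∂ρ
      ≤ B * ENNReal.ofReal (lam N) * ENNReal.ofReal (tailKernel lam φ N x x) := fun x => by
    refine (lintegral_le_mul_of_rnDeriv_le hac hB _).trans ?_
    have hcx : Continuous (tailKernel lam φ N x) := hc.comp (Continuous.prodMk_right x)
    have hint : Integrable (fun y => tailKernel lam φ N x y ^ 2) P :=
      integrable_of_continuous (hcx.pow 2)
    rw [mul_assoc, ← ENNReal.ofReal_mul (hE.nonneg N), ← ofReal_integral_eq_lintegral_ofReal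
      hint (Eventually.of_forall fun y => sq_nonneg _)]
    gcongr
    exact integral_tailKernel_sq_le hE hS N x
  have hm : Measurable fun p : X × X => ENNReal.ofReal (tailKernel lam φ N p.1 p.2 ^ 2) :=
    (hc.pow 2).measurable.ennreal_ofReal
  rw [lintegral_prod _ hm.aemeasurable]
  refine (lintegral_mono hx).trans ?_
  rw [lintegral_const_mul' _ _ (ENNReal.mul_ne_top ENNReal.coe_ne_top ENNReal.ofReal_ne_top)]
  refine (mul_le_mul_right (lintegral_tailKernel_self_sample_le hE hS hac hB N) _).trans_eq ?_
  rw [ENNReal.ofReal_mul (by positivity), ENNReal.ofReal_pow (by positivity),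
    ENNReal.ofReal_coe_nnreal]
  ring

variable [T2Space X]

/-- On the support `R(x, x) ≤ K(x, x) ≤ κ`, so one of the two factors is bounded and the other is
integrated. -/
theorem lintegral_tailKernel_sq_diag_le (hK : Continuous fun p : X × X => K p.1 p.2) {κ : ℝ≥0}
    (hκ : ∀ x, K x x ≤ κ) (hE : IsEigensystem K P lam φ)
    (hS : Summable fun k => lam k * ‖φ k‖ ^ 2) (hac : ρ ≪ P) {B : ℝ≥0}
    (hB : ∀ᵐ x ∂P, ρ.rnDeriv P x ≤ (B : ℝ≥0∞)) (N : ℕ) :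
    ∫⁻ x, ENNReal.ofReal (tailKernel lam φ N x x ^ 2) ∂ρ
      ≤ ENNReal.ofReal (κ * B) * ∑' k, ENNReal.ofReal (lam (N + k) * ‖φ (N + k)‖ ^ 2) := by
  have h : ∀ᵐ x ∂ρ, ENNReal.ofReal (tailKernel lam φ N x x ^ 2)
      ≤ κ * ENNReal.ofReal (tailKernel lam φ N x x) := by
    filter_upwards [hac.ae_le P.support_mem_ae] with x hx
    have h0 := tailKernel_self_nonneg (φ := φ) hE.nonneg N x
    rw [← ENNReal.ofReal_coe_nnreal, ← ENNReal.ofReal_mul κ.coe_nonneg]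
    refine ENNReal.ofReal_le_ofReal ?_
    rw [sq]
    exact mul_le_mul_of_nonneg_right ((tailKernel_self_le hK hE hS N hx).trans (hκ x)) h0
  refine (lintegral_mono_ae h).trans ?_
  rw [lintegral_const_mul' _ _ ENNReal.coe_ne_top, ENNReal.ofReal_mul κ.coe_nonneg,
    ENNReal.ofReal_coe_nnreal, ENNReal.ofReal_coe_nnreal, mul_assoc]
  gcongr
  exact lintegral_tailKernel_self_sample_le hE hS hac hB N

theorem lintegral_tailKernel_sample_le [IsProbabilityMeasure μ]
    (hK : Continuous fun p : X × X => K p.1 p.2) {κ : ℝ≥0} (hκ : ∀ x, K x x ≤ κ)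
    (hE : IsEigensystem K P lam φ)
    (hS : Summable fun k => lam k * ‖φ k‖ ^ 2) (hac : ρ ≪ P) {B : ℝ≥0}
    (hB : ∀ᵐ x ∂P, ρ.rnDeriv P x ≤ (B : ℝ≥0∞)) (hSm : ∀ i, Measurable (S i))
    (hind : iIndepFun S μ) (hlaw : ∀ i, μ.map (S i) = ρ) (N : ℕ) (i l : Fin n) :
    ∫⁻ ω, ENNReal.ofReal (tailKernel lam φ N (S i ω) (S l ω) ^ 2) ∂μ
      ≤ ENNReal.ofReal ((if i = l then (κ : ℝ) * B else 0) + B ^ 2 * lam N) *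
        ∑' k, ENNReal.ofReal (lam (N + k) * ‖φ (N + k)‖ ^ 2) := by
  have hc := continuous_tailKernel (φ := φ) hE.nonneg hS N
  have hm : Measurable fun p : X × X => ENNReal.ofReal (tailKernel lam φ N p.1 p.2 ^ 2) :=
    (hc.pow 2).measurable.ennreal_ofReal
  have hlam := hE.nonneg N
  by_cases h : i = l
  · subst h
    have hmd : Measurable fun x : X => ENNReal.ofReal (tailKernel lam φ N x x ^ 2) :=
      hm.comp (f := fun x : X => (x, x)) (measurable_id.prodMk measurable_id)
    have h1 := lintegral_map (μ := μ) hmd (hSm i)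
    rw [hlaw] at h1
    refine h1.symm.le.trans ((lintegral_tailKernel_sq_diag_le hK hκ hE hS hac hB N).trans ?_)
    gcongr
    rw [if_pos rfl]
    exact le_add_of_nonneg_right (by positivity)
  · have hp := (hind.indepFun h).map_prod_eq_prod_map_map (hSm i).aemeasurable (hSm l).aemeasurable
    rw [hlaw, hlaw] at hp
    have h1 := lintegral_map (μ := μ) hm ((hSm i).prodMk (hSm l))
    rw [hp] at h1
    rw [if_neg h, zero_add]
    refine h1.symm.le.trans ?_
    exact lintegral_tailKernel_sq_prod_le hE hS hac hB N

end Risk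

/-! ### The risk bound -/

section Main

theorem ae_sample_of_ae {X Ω : Type*} [MeasurableSpace X] [MeasurableSpace Ω] {P ρ : Measure X}
    {μ : Measure Ω} {n : ℕ} {S : Fin n → Ω → X} (hac : ρ ≪ P) (hSm : ∀ i, Measurable (S i))
    (hlaw : ∀ i, μ.map (S i) = ρ) {p : X → Prop} (h : ∀ᵐ x ∂P, p x) :
    ∀ᵐ ω ∂μ, ∀ i, p (S i ω) := by
  rw [ae_all_iff]
  intro i
  have h' : ∀ᵐ x ∂(μ.map (S i)), p x := by rw [hlaw i]; exact hac.ae_le h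
  exact ae_of_ae_map (hSm i).aemeasurable h'

variable {X : Type*} [TopologicalSpace X] [MeasurableSpace X] [BorelSpace X]
  [SecondCountableTopology X] [CompactSpace X] [T2Space X]
  {P ρ : Measure X} [IsProbabilityMeasure P] [IsProbabilityMeasure ρ] {K : X → X → ℝ}
  {lam : ℕ → ℝ} {φ : ℕ → C(X, ℝ)} {f : X → ℝ} {n N : ℕ} {hN : N ≤ n} {r : ℝ}
  {Ω : Type*} [MeasurableSpace Ω] {μ : Measure Ω} [IsProbabilityMeasure μ]
  {S : Fin n → Ω → X} {σ : ℝ} {ε : Fin n → Ω → ℝ}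

/-- The risk bound for a measurable regression function and a summable Mercer series. -/
theorem risk_le_of_summable {κ B : ℝ≥0} (hK : IsMercerKernel K) (hκ : ∀ x, K x x ≤ κ)
    (hE : IsEigensystem K P lam φ) (hac : ρ ≪ P)
    (hB : ∀ᵐ x ∂P, ρ.rnDeriv P x ≤ (B : ℝ≥0∞)) (hfm : Measurable f) (hf : MemRKHS P lam φ f)
    (hN0 : 0 < N) (hr : 0 < r) (hSm : ∀ i, Measurable (S i)) (hSi : iIndepFun S μ)
    (hlaw : ∀ i, μ.map (S i) = ρ) (hεm : ∀ i, Measurable (ε i)) (hind : iIndepFun ε μ)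
    (h2 : ∀ i, MemLp (ε i) 2 μ) (h0 : ∀ i, ∫ ω, ε i ω ∂μ = 0)
    (hσ : ∀ i, ∫ ω, ε i ω ^ 2 ∂μ = σ ^ 2)
    (hSε : IndepFun (fun ω i => S i ω) (fun ω i => ε i ω) μ) {G : Set (Fin n → X)}
    (hG : MeasurableSet G)
    (hH : ∀ᵐ ω ∂μ, (fun i => S i ω) ∈ G → ∃ w : Fin N → ℝ,
      (∀ z, eigenProj P φ N f z = kernelComb (truncKernel lam φ N) hN (fun i => S i ω) w z) ∧
        1 / (n : ℝ) * ∑ j, w j ^ 2 ≤ 1)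
    (hsum : Summable fun k => lam k * ‖φ k‖ ^ 2) :
    ∫⁻ ω in {ω | (fun i => S i ω) ∈ G}, ENNReal.ofReal
        (empError K hN r f (fun i => S i ω) (fun i => ε i ω)) ∂μ
      ≤ riskBound (4 * B + 4 * κ * B + 4 * κ * B ^ 2 + 1) K P lam φ hN r σ f μ
        (fun ω i => S i ω) := by
  have hn0 : 0 < n := hN0.trans_le hN
  have hn' : (0 : ℝ) < n := by exact_mod_cast hn0
  have hKc := hK.continuous
  have hS : Measurable fun ω i => S i ω := measurable_pi_lambda _ hSm
  have hc := continuous_tailKernel (φ := φ) hE.nonneg hsum N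
  set Q := ENNReal.ofReal (lam N) * rkhsNormSq P lam φ f with hQ
  set T := ∑' k, ENNReal.ofReal (lam (N + k) * ‖φ (N + k)‖ ^ 2) with hT
  let V : Fin N → Ω → ℝ≥0∞ := fun j ω => ENNReal.ofReal
    ((mu K hN (fun i => S i ω) j ^ 2 / (mu K hN (fun i => S i ω) j ^ 2 + r)) ^ 2)
  let a : Fin n → Ω → ℝ≥0∞ := fun i ω =>
    ENNReal.ofReal ((f (S i ω) - eigenProj P φ N f (S i ω)) ^ 2)
  let t : Fin n → Fin N → Ω → ℝ≥0∞ := fun i j ω =>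
    ENNReal.ofReal (tailKernel lam φ N (S (Fin.castLE hN j) ω) (S i ω) ^ 2)
  have hV : ∀ j, Measurable (V j) := fun j => by
    have h := (measurable_mu_sq hKc hN j).comp hS
    exact ((h.div (h.add_const r)).pow_const 2).ennreal_ofReal
  have ha : ∀ i, Measurable (a i) := fun i =>
    (((hfm.comp (hSm i)).sub ((continuous_eigenProj N).measurable.comp (hSm i))).pow_const
      2).ennreal_ofReal
  have ht : ∀ i j, Measurable (t i j) := fun i j =>
    ((hc.measurable.comp (f := fun ω => (S (Fin.castLE hN j) ω, S i ω))
      ((hSm _).prodMk (hSm i))).pow_const 2).ennreal_ofReal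
  have hbias : ∀ᵐ ω ∂μ, (fun i => S i ω) ∈ G →
      ENNReal.ofReal (1 / (n : ℝ) * ∑ i, bias K hN r f (fun i => S i ω) i ^ 2)
        ≤ ENNReal.ofReal (r / 2) + ENNReal.ofReal (4 / n) * ∑ i, a i ω
          + ENNReal.ofReal (4 / (n : ℝ) ^ 2) * ∑ i, ∑ j, t i j ω := by
    filter_upwards [hH, ae_sample_of_ae hac hSm hlaw P.support_mem_ae] with ω hω hsupp hmem
    obtain ⟨w, hw, hw1⟩ := hω hmem
    have h := empiricalBias_le (hN := hN) (f := f) (R := tailKernel lam φ N) hK.symm hr hn0 hw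
      (fun i j => kernel_sub_truncKernel hKc hE hsum N (hsupp i) (hsupp j)) hw1
    refine (ENNReal.ofReal_le_ofReal h).trans_eq ?_
    have p1 : 0 ≤ ∑ i, (f (S i ω) - eigenProj P φ N f (S i ω)) ^ 2 :=
      Finset.sum_nonneg fun i _ => sq_nonneg _
    have p2 : ∀ i, 0 ≤ ∑ j, tailKernel lam φ N (S (Fin.castLE hN j) ω) (S i ω) ^ 2 :=
      fun i => Finset.sum_nonneg fun j _ => sq_nonneg _
    have p3 := Finset.sum_nonneg fun i (_ : i ∈ Finset.univ) => p2 i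
    rw [ENNReal.ofReal_add (by positivity) (by positivity),
      ENNReal.ofReal_add (by positivity) (by positivity), ENNReal.ofReal_mul (by positivity),
      ENNReal.ofReal_mul (by positivity), ENNReal.ofReal_sum_of_nonneg fun i _ => sq_nonneg _,
      ENNReal.ofReal_sum_of_nonneg fun i _ => p2 i]
    simp only [ENNReal.ofReal_sum_of_nonneg fun _ _ => sq_nonneg _, a, t]
  have hGm : MeasurableSet {ω | (fun i => S i ω) ∈ G} := hS hG
  have hA : ∫⁻ ω, ENNReal.ofReal (4 / n) * ∑ i, a i ω ∂μ ≤ 4 * B * Q := by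
    rw [lintegral_const_mul' _ _ ENNReal.ofReal_ne_top, lintegral_finsetSum _ fun i _ => ha i]
    calc ENNReal.ofReal (4 / n) * ∑ i, ∫⁻ ω, a i ω ∂μ
        ≤ ENNReal.ofReal (4 / n) * ∑ _i : Fin n, B * Q := by
          gcongr with i
          exact lintegral_residual_sample_le hE hac hB hfm hf hSm hlaw N i
      _ = ENNReal.ofReal (4 / n) * ENNReal.ofReal n * (B * Q) := by
          simp [mul_assoc]
      _ = 4 * B * Q := by
          rw [← ENNReal.ofReal_mul (by positivity), div_mul_cancel₀ _ hn'.ne', mul_assoc]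
          simp
  have hTt : ∫⁻ ω, ENNReal.ofReal (4 / (n : ℝ) ^ 2) * ∑ i, ∑ j, t i j ω ∂μ
      ≤ (4 * κ * B + 4 * κ * B ^ 2) * ((N : ℝ≥0∞)⁻¹ * T) := by
    rw [lintegral_const_mul' _ _ ENNReal.ofReal_ne_top,
      lintegral_finsetSum _ fun i _ => Finset.measurable_sum _ fun j _ => ht i j]
    have hcoef : ∀ i : Fin n, ∀ j : Fin N,
        0 ≤ (if Fin.castLE hN j = i then (κ : ℝ) * B else 0) + B ^ 2 * lam N := fun i j => by
      have := hE.nonneg N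
      split_ifs <;> positivity
    calc ENNReal.ofReal (4 / (n : ℝ) ^ 2) * ∑ i, ∫⁻ ω, ∑ j, t i j ω ∂μ
        ≤ ENNReal.ofReal (4 / (n : ℝ) ^ 2) * ∑ i : Fin n, ∑ j : Fin N, ENNReal.ofReal
          ((if Fin.castLE hN j = i then (κ : ℝ) * B else 0) + B ^ 2 * lam N) * T := by
          gcongr with i
          rw [lintegral_finsetSum _ fun j _ => ht i j]
          gcongr with j
          exact lintegral_tailKernel_sample_le hKc hκ hE hsum hac hB hSm hSi hlaw N _ i
      _ = ENNReal.ofReal (4 / (n : ℝ) ^ 2 * ∑ i : Fin n, ∑ j : Fin N,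
          ((if Fin.castLE hN j = i then (κ : ℝ) * B else 0) + B ^ 2 * lam N)) * T := by
          rw [ENNReal.ofReal_mul (by positivity),
            ENNReal.ofReal_sum_of_nonneg fun i _ => Finset.sum_nonneg fun j _ => hcoef i j]
          simp only [ENNReal.ofReal_sum_of_nonneg fun j _ => hcoef _ j, ← Finset.sum_mul, mul_assoc]
      _ ≤ ENNReal.ofReal ((4 * κ * B + 4 * κ * B ^ 2) * (N : ℝ)⁻¹) * T := by
          exact mul_le_mul_left (ENNReal.ofReal_le_ofReal (sum_pair_coefficient_le κ.coe_nonneg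
            B.coe_nonneg (mul_eigenvalue_le hKc hκ hE hsum N) hN0 hN)) _
      _ = _ := by
          have e : (4 * κ * B + 4 * κ * B ^ 2 : ℝ) = ((4 * κ * B + 4 * κ * B ^ 2 : ℝ≥0) : ℝ) := by
            push_cast; rfl
          rw [ENNReal.ofReal_mul (by positivity), ENNReal.ofReal_inv_of_pos (by exact_mod_cast hN0),
            ENNReal.ofReal_natCast, e, ENNReal.ofReal_coe_nnreal, mul_assoc]
          push_cast
          rfl
  have hm1 : Measurable fun ω => ENNReal.ofReal (4 / n) * ∑ i, a i ω :=
    (Finset.measurable_sum _ fun i _ => ha i).const_mul _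
  have hm2 : Measurable fun ω => ENNReal.ofReal (4 / (n : ℝ) ^ 2) * ∑ i, ∑ j, t i j ω :=
    (Finset.measurable_sum _ fun i _ => Finset.measurable_sum _ fun j _ => ht i j).const_mul _
  have hm3 : Measurable fun ω => ENNReal.ofReal (r / 2) + ENNReal.ofReal (4 / n) * ∑ i, a i ω :=
    measurable_const.add hm1
  have hm4 : Measurable fun ω => ENNReal.ofReal (r / 2) + ENNReal.ofReal (4 / n) * ∑ i, a i ω
      + ENNReal.ofReal (4 / (n : ℝ) ^ 2) * ∑ i, ∑ j, t i j ω := hm3.add hm2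
  calc ∫⁻ ω in {ω | (fun i => S i ω) ∈ G}, ENNReal.ofReal
        (empError K hN r f (fun i => S i ω) (fun i => ε i ω)) ∂μ
      ≤ ∫⁻ ω in {ω | (fun i => S i ω) ∈ G}, (ENNReal.ofReal (r / 2)
          + ENNReal.ofReal (4 / n) * ∑ i, a i ω
          + ENNReal.ofReal (4 / (n : ℝ) ^ 2) * ∑ i, ∑ j, t i j ω
          + ENNReal.ofReal (σ ^ 2 / n) * ∑ j, V j ω) ∂μ := by
        rw [setLIntegral_empError hK.symm hKc hr hfm hSm hεm hind h2 h0 hσ hSε hG]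
        refine setLIntegral_mono_ae' hGm ?_
        filter_upwards [hbias] with ω hω hmem
        exact add_le_add_left (hω hmem) _
    -- The event was needed only to have the comparison vector; the bound is nonnegative and is now
    -- integrated over the whole space.
    _ ≤ ∫⁻ ω, (ENNReal.ofReal (r / 2) + ENNReal.ofReal (4 / n) * ∑ i, a i ω
          + ENNReal.ofReal (4 / (n : ℝ) ^ 2) * ∑ i, ∑ j, t i j ω
          + ENNReal.ofReal (σ ^ 2 / n) * ∑ j, V j ω) ∂μ := setLIntegral_le_lintegral _ _
    _ = ENNReal.ofReal (r / 2) + ∫⁻ ω, ENNReal.ofReal (4 / n) * ∑ i, a i ω ∂μ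
          + ∫⁻ ω, ENNReal.ofReal (4 / (n : ℝ) ^ 2) * ∑ i, ∑ j, t i j ω ∂μ
          + ENNReal.ofReal (σ ^ 2 / n) * ∑ j, ∫⁻ ω, V j ω ∂μ := by
        rw [lintegral_add_left hm4, lintegral_add_left hm3, lintegral_add_left measurable_const,
          lintegral_const, measure_univ, mul_one, lintegral_const_mul' (ENNReal.ofReal (σ ^ 2 / n)) _
            ENNReal.ofReal_ne_top,
          lintegral_finsetSum _ fun j _ => hV j]
    _ ≤ ENNReal.ofReal (r / 2) + 4 * B * Q
          + (4 * κ * B + 4 * κ * B ^ 2) * ((N : ℝ≥0∞)⁻¹ * T)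
          + ENNReal.ofReal (2 * σ ^ 2 / n) * ∑ j, ∫⁻ ω, V j ω ∂μ := by
        gcongr
        -- The argument gives `σ²`; the stated bound allows `2 σ²`.
        nlinarith [sq_nonneg σ]
    _ ≤ _ := by
        have hC1 : (4 * B : ℝ≥0∞) ≤ ((4 * B + 4 * κ * B + 4 * κ * B ^ 2 + 1 : ℝ≥0) : ℝ≥0∞) := by
          push_cast
          rw [add_assoc, add_assoc]
          exact le_self_add
        have hC2 : (4 * κ * B + 4 * κ * B ^ 2 : ℝ≥0∞)
            ≤ ((4 * B + 4 * κ * B + 4 * κ * B ^ 2 + 1 : ℝ≥0) : ℝ≥0∞) := by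
          push_cast
          rw [add_assoc (4 * (B : ℝ≥0∞))]
          exact le_add_self.trans le_self_add
        rw [riskBound, ← hQ, ← hT, mul_add, add_right_comm, add_right_comm (ENNReal.ofReal (r / 2)),
          add_assoc]
        gcongr

theorem risk_le {κ B : ℝ≥0} (hK : IsMercerKernel K) (hκ : ∀ x, K x x ≤ κ)
    (hE : IsEigensystem K P lam φ) (hac : ρ ≪ P)
    (hB : ∀ᵐ x ∂P, ρ.rnDeriv P x ≤ (B : ℝ≥0∞)) (hf : MemRKHS P lam φ f)
    (hN0 : 0 < N) (hr : 0 < r) (hSm : ∀ i, Measurable (S i)) (hSi : iIndepFun S μ)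
    (hlaw : ∀ i, μ.map (S i) = ρ) (hεm : ∀ i, Measurable (ε i)) (hind : iIndepFun ε μ)
    (h2 : ∀ i, MemLp (ε i) 2 μ) (h0 : ∀ i, ∫ ω, ε i ω ∂μ = 0)
    (hσ : ∀ i, ∫ ω, ε i ω ^ 2 ∂μ = σ ^ 2)
    (hSε : IndepFun (fun ω i => S i ω) (fun ω i => ε i ω) μ) {G : Set (Fin n → X)}
    (hG : MeasurableSet G)
    (hH : ∀ᵐ ω ∂μ, (fun i => S i ω) ∈ G → H3 K P lam φ hN f (fun i => S i ω)) :
    ∫⁻ ω in {ω | (fun i => S i ω) ∈ G}, ENNReal.ofReal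
        (empError K hN r f (fun i => S i ω) (fun i => ε i ω)) ∂μ
      ≤ riskBound (4 * B + 4 * κ * B + 4 * κ * B ^ 2 + 1) K P lam φ hN r σ f μ
        (fun ω i => S i ω) := by
  -- A divergent tail makes the bound infinite. The summand `1` keeps the constant nonzero even if
  -- `κ = B = 0`.
  by_cases hT : ∑' k, ENNReal.ofReal (lam (N + k) * ‖φ (N + k)‖ ^ 2) = ∞
  · have h1 : ((4 * B + 4 * κ * B + 4 * κ * B ^ 2 + 1 : ℝ≥0) : ℝ≥0∞) ≠ 0 := by
      rw [ENNReal.coe_ne_zero]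
      positivity
    have h2 : (N : ℝ≥0∞)⁻¹ ≠ 0 := ENNReal.inv_ne_zero.mpr (ENNReal.natCast_ne_top N)
    rw [riskBound, hT, ENNReal.mul_top h2, add_top, ENNReal.mul_top h1, add_top]
    exact le_top
  have hsum := summable_of_tsum_ne_top hE N hT
  -- Elements of `L²(P)` are only almost everywhere measurable. A measurable version has the same
  -- coefficients and, as `ρ ≪ P`, almost surely the same values at the sample points.
  set g := hf.memLp.1.mk f with hg
  have hgm : Measurable g := hf.memLp.1.stronglyMeasurable_mk.measurable
  have hfg : f =ᵐ[P] g := hf.memLp.1.ae_eq_mk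
  have hcoeff : coeff P φ f = coeff P φ g := funext fun k => integral_congr_ae <| by
    filter_upwards [hfg] with x hx
    rw [hx]
  have hproj : ∀ M, eigenProj P φ M f = eigenProj P φ M g := fun M => by
    unfold eigenProj; rw [hcoeff]
  have hnorm : rkhsNormSq P lam φ f = rkhsNormSq P lam φ g := by
    unfold rkhsNormSq; rw [hcoeff]
  have hmem : MemRKHS P lam φ g := by
    refine ⟨hf.memLp.ae_eq hfg, hf.expansion.congr fun M => integral_congr_ae ?_, hnorm ▸ hf.3⟩
    filter_upwards [hfg] with x hx
    rw [hx, hproj]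
  have hae : ∀ᵐ ω ∂μ, ∀ i, f (S i ω) = g (S i ω) := ae_sample_of_ae hac hSm hlaw hfg
  have hrisk : riskBound (4 * B + 4 * κ * B + 4 * κ * B ^ 2 + 1) K P lam φ hN r σ f μ
      (fun ω i => S i ω) = riskBound (4 * B + 4 * κ * B + 4 * κ * B ^ 2 + 1) K P lam φ hN r σ g μ
      (fun ω i => S i ω) := by
    unfold riskBound; rw [hnorm]
  rw [hrisk]
  refine le_of_eq_of_le (lintegral_congr_ae (ae_restrict_of_ae ?_))
    (risk_le_of_summable hK hκ hE hac hB hgm hmem hN0 hr hSm hSi hlaw hεm hind h2 h0 hσ hSε hG ?_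
      hsum)
  · filter_upwards [hae] with ω hω
    simp only [empError, hω]
  · filter_upwards [hH] with ω hω hmemG
    obtain ⟨_, w, -, hw, hmax⟩ := hω hmemG
    exact ⟨w, fun z => hproj N ▸ hw z, (le_max_right _ _).trans hmax⟩

end Main

end TKRR

theorem theorem2 :
    -- the constant depends only on a bound `κ` of `K(x, x)` and a bound `B` of `dρ/dP`
    ∀ κ B : ℝ≥0, ∃ C₁ : ℝ≥0, 0 < C₁ ∧
    ∀ (d : ℕ) (X : Set (EuclideanSpace ℝ (Fin d))) [CompactSpace X]
      (K : X → X → ℝ) (_ : TKRR.IsMercerKernel K) (_ : ∀ x, K x x ≤ κ)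
      (P ρ : Measure X) [IsProbabilityMeasure P] [IsProbabilityMeasure ρ]
      (lam : ℕ → ℝ) (φ : ℕ → C(X, ℝ)) (_ : TKRR.IsEigensystem K P lam φ)
      -- hypothesis H1
      (_ : ρ ≪ P) (_ : ∀ᵐ x ∂P, ρ.rnDeriv P x ≤ (B : ℝ≥0∞))
      -- the regression function, in the RKHS
      (fstar : X → ℝ) (_ : TKRR.MemRKHS P lam φ fstar)
      (n N : ℕ) (_ : 0 < N) (hN : N ≤ n) (reg : ℝ) (_ : 0 < reg)
      -- i.i.d. sampling points with law `ρ`, independent of the i.i.d. noise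
      (Ω : Type*) [MeasurableSpace Ω] (μ : Measure Ω) [IsProbabilityMeasure μ]
      (S : Fin n → Ω → X) (_ : ∀ i, Measurable (S i)) (_ : iIndepFun S μ)
      (_ : ∀ i, μ.map (S i) = ρ)
      (σ : ℝ) (ε : Fin n → Ω → ℝ) (_ : ∀ i, Measurable (ε i)) (_ : iIndepFun ε μ)
      (_ : ∀ i j, IdentDistrib (ε i) (ε j) μ μ) (_ : ∀ i, MemLp (ε i) 2 μ)
      (_ : ∀ i, ∫ ω, ε i ω ∂μ = 0) (_ : ∀ i, ∫ ω, ε i ω ^ 2 ∂μ = σ ^ 2)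
      (_ : IndepFun (fun ω i => S i ω) (fun ω i => ε i ω) μ),
      -- if H2 and H3 hold almost surely, the bound holds for the expected empirical risk
      ((∀ᵐ ω ∂μ, TKRR.H2 N φ (fun i => S i ω) ∧
            TKRR.H3 K P lam φ hN fstar (fun i => S i ω)) →
        ∫⁻ ω, ENNReal.ofReal
            (TKRR.empError K hN reg fstar (fun i => S i ω) (fun i => ε i ω)) ∂μ ≤
          TKRR.riskBound C₁ K P lam φ hN reg σ fstar μ (fun ω i => S i ω)) ∧
      -- more generally, if H2 and H3 hold on an event `G` of the sampling points, the bound holds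
      -- for the expected empirical risk on that event
      (∀ G : Set (Fin n → X), MeasurableSet G →
        (∀ᵐ ω ∂μ, (fun i => S i ω) ∈ G → TKRR.H2 N φ (fun i => S i ω) ∧
            TKRR.H3 K P lam φ hN fstar (fun i => S i ω)) →
        ∫⁻ ω in {ω | (fun i => S i ω) ∈ G}, ENNReal.ofReal
            (TKRR.empError K hN reg fstar (fun i => S i ω) (fun i => ε i ω)) ∂μ ≤
          TKRR.riskBound C₁ K P lam φ hN reg σ fstar μ (fun ω i => S i ω)) := by
  intro κ B
  -- `4 B` comes from the spectral remainder, `4 κ B` from the diagonal pairs, `4 κ B²` from the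
  -- bound for distinct pairs, and `1` ensures positivity.
  refine ⟨4 * B + 4 * κ * B + 4 * κ * B ^ 2 + 1, by positivity, ?_⟩
  intro d X _ K hK hκ P ρ _ _ lam φ hE hac hB fstar hf n N hN0 hN reg hreg Ω _ μ _ S hSm hSi hlaw
    σ ε hεm hind _ h2 h0 hσ hSε
  have key : ∀ G : Set (Fin n → X), MeasurableSet G →
      (∀ᵐ ω ∂μ, (fun i => S i ω) ∈ G → TKRR.H2 N φ (fun i => S i ω) ∧
        TKRR.H3 K P lam φ hN fstar (fun i => S i ω)) →
      ∫⁻ ω in {ω | (fun i => S i ω) ∈ G}, ENNReal.ofReal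
          (TKRR.empError K hN reg fstar (fun i => S i ω) (fun i => ε i ω)) ∂μ ≤
        TKRR.riskBound (4 * B + 4 * κ * B + 4 * κ * B ^ 2 + 1) K P lam φ hN reg σ fstar μ
          (fun ω i => S i ω) := fun G hG hH =>
    TKRR.risk_le hK hκ hE hac hB hf hN0 hreg hSm hSi hlaw hεm hind h2 h0 hσ hSε hG
      (hH.mono fun ω hω hmem => (hω hmem).2)
  refine ⟨fun hH => ?_, key⟩
  have h := key Set.univ MeasurableSet.univ (hH.mono fun ω hω _ => hω)
  simpa using h
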